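/- **Setting.** Let $N,B\in\mathbb{Z}_{\ge 1}$, $\delta>0$, and let $\mathcal{D}\subseteq\mathbb{R}^{d}$, $\mathcal{Z}\subseteq\mathbb{R}^{e}$ be closed convex sets. Let $\{\mathcal{G}_t\}_{t\ge 1}$ be weighted digraphs on the vertex set $\{1,\dots,N\}$ with nonnegative adjacency matrices $\mathsf{A}_t=(a_{ij,t})$, where $(i,j)$ is an edge of $\mathcal{G}_t$ if and only if $a_{ij,t}>0$. Assume that the sequence is * *$B$-jointly connected*: for each $k\ge 1$ the union $\mathcal{G}_{kB}\cup\dots\cup\mathcal{G}_{(k+1)B-1}$ is strongly connected; * *$\delta$-nondegenerate*: for all $t\ge1$, $a_{ij,t}>\delta$ whenever $a_{ij,t}>0$; * *weight-balanced*: $\sum_j a_{ij,t}=\sum_j a_{ji,t}$ for all $i$ and all $t\ge1$; and that the maximal out-degree $d_{\max}:=\sup_{i,\,t\ge 1}\sum_j a_{ij,t}$ is finite (and positive, which is automatic for $N\ge2$). Let $\mathsf{L}_t=\operatorname{diag}(\mathsf{A}_t\mathbf{1})-\mathsf{A}_t$, $\mathbf{L}_t=\mathsf{L}_t\otimes \mathrm{I}$,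 and $\mathbf{L}_{\mathcal K}=(\mathrm{I}_N-\tfrac1N\mathbf{1}\mathbf{1}^\top)\otimes \mathrm{I}$, where $\mathrm{I}$ is the identity of dimension $d$ or $e$ depending on the context. For $\tilde\delta'\in(0,1)$ put $$\tilde\delta:=\min\Big\{\tilde\delta',\,(1-\tilde\delta')\frac{\delta}{d_{\max}}\Big\},\qquad C_u:=\frac{2^5/3^2}{1-\big(1-\frac{\tilde\delta}{4N^2}\big)^{1/B}},$$ and let $\sigma\in\big[\tilde\delta/\delta,\ (1-\tilde\delta)/d_{\max}\big]$. Consider the dynamics, for $t\ge 1$ and arbitrary disturbances $u^1_t\in(\mathbb{R}^d)^N$, $u^2_t\in(\mathbb{R}^e)^N$, $$\hat D_{t+1}=D_t-\sigma\mathbf{L}_tD_t+u^1_t,\quad \hat z_{t+1}=z_t-\sigma\mathbf{L}_tz_t+u^2_t,\quad (D_{t+1},z_{t+1})=\mathcal{P}_{\mathcal{D}^N\times\mathcal{Z}^N}(\hat D_{t+1},\hat z_{t+1}),$$ with arbitrary initial state $(D_1,z_1)\in(\mathbb{R}^d)^N\times(\mathbb{R}^e)^N$, where $\mathcal{P}$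 is the orthogonal projection and all norms are Euclidean. **Proposition.** The dynamics of $D_t$ is input-to-state stable with respect to the nullspace of $\mathbf{L}_{\mathcal K}$: there are a class-$\mathcal{KL}$ function $\beta$ and a class-$\mathcal{K}$ function $\gamma$ such that along every trajectory and for all $t\ge1$, $\operatorname{dist}(D_t,\ker\mathbf{L}_{\mathcal K})\le\beta(\operatorname{dist}(D_1,\ker\mathbf{L}_{\mathcal K}),t-1)+\gamma(\max_{1\le s\le t-1}\|u^1_s\|)$. Specifically, for every trajectory and every $t\ge 1$, $$\|\mathbf{L}_{\mathcal K}D_t\|\le\frac{2^4\|D_1\|}{3^2}\Big(1-\frac{\tilde\delta}{4N^2}\Big)^{\lceil\frac{t-1}{B}\rceil}+C_u\max_{1\le s\le t-1}\|u^1_s\|,$$ and, for every $t'\ge1$, the cumulative disagreement satisfies $$\sum_{t=1}^{t'}\|\mathbf{L}_{\mathcal K}D_t\|\le C_u\Big(\frac{\|D_1\|}{2}+\sum_{t=1}^{t'-1}\|u^1_t\|\Big)$$ (a maximum over the empty set is $0$). The same statements hold with $(z_t,u^2_t)$ in place of $(D_t,u^1_t)$. -/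

import Mathlib

open scoped NNReal

namespace LaplacianAveraging

/-- A weighted digraph with vertex set `{1, …, N}`: an edge set together with a nonnegative
adjacency matrix whose positive entries are exactly the edges. Self-loops are allowed. -/
structure WeightedDigraph (N : ℕ) where
  edges : Set (Fin N × Fin N)
  adj : Matrix (Fin N) (Fin N) ℝ
  adj_nonneg : ∀ i j, 0 ≤ adj i j
  adj_pos_iff : ∀ i j, 0 < adj i j ↔ (i, j) ∈ edges

namespace WeightedDigraph

variable {N : ℕ}

/-- The union of the digraphs `G t`, `t ∈ s`: edge sets are united, adjacency matrices added. -/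
def biUnion (s : Finset ℕ) (G : ℕ → WeightedDigraph N) : WeightedDigraph N where
  edges := ⋃ t ∈ s, (G t).edges
  adj := ∑ t ∈ s, (G t).adj
  adj_nonneg := by
    intro i j
    rw [Matrix.sum_apply]
    exact Finset.sum_nonneg fun t _ => (G t).adj_nonneg i j
  adj_pos_iff := by
    intro i j
    rw [Matrix.sum_apply, Finset.sum_pos_iff_of_nonneg fun t _ => (G t).adj_nonneg i j]
    simp [(G _).adj_pos_iff]

/-- There is a directed path between any two distinct vertices. -/
def StronglyConnected (G : WeightedDigraph N) : Prop :=
  ∀ i j, i ≠ j → Relation.ReflTransGen (fun a b => (a, b) ∈ G.edges) i j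

/-- Weighted out-degree. -/
def outDegree (G : WeightedDigraph N) (i : Fin N) : ℝ := ∑ j, G.adj i j

/-- Weighted in-degree. -/
def inDegree (G : WeightedDigraph N) (i : Fin N) : ℝ := ∑ j, G.adj j i

def WeightBalanced (G : WeightedDigraph N) : Prop := ∀ i, G.outDegree i = G.inDegree i

/-- The Laplacian matrix `diag(A 𝟙) - A`. -/
def laplacian (G : WeightedDigraph N) : Matrix (Fin N) (Fin N) ℝ :=
  Matrix.diagonal G.outDegree - G.adj

end WeightedDigraph

section Sequences

variable {N : ℕ}

/-! Sequences of digraphs are indexed by times `t ≥ 1`; the entry at index `0` plays no role. -/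

/-- `δ`-nondegeneracy: positive weights are larger than `δ`. -/
def Nondegenerate (δ : ℝ) (G : ℕ → WeightedDigraph N) : Prop :=
  ∀ t, 1 ≤ t → ∀ i j, 0 < (G t).adj i j → δ < (G t).adj i j

/-- `B`-joint connectivity: for each `k ≥ 1` the union of `G (k B), …, G ((k + 1) B - 1)` is
strongly connected. -/
def JointlyConnected (B : ℕ) (G : ℕ → WeightedDigraph N) : Prop :=
  ∀ k, 1 ≤ k →
    (WeightedDigraph.biUnion (Finset.Ico (k * B) ((k + 1) * B)) G).StronglyConnected

/-- All the out-degrees occurring along the sequence. -/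
def outDegrees (G : ℕ → WeightedDigraph N) : Set ℝ :=
  {x | ∃ k : Fin N, ∃ t : ℕ, 1 ≤ t ∧ x = (G t).outDegree k}

/-- The maximal out-degree `d_max` along the sequence (meaningful if they are bounded). -/
noncomputable def maxOutDegree (G : ℕ → WeightedDigraph N) : ℝ := sSup (outDegrees G)

/-- `δ̃ = min {δ', (1 - δ') δ / d_max}`. -/
noncomputable def deltaTilde (G : ℕ → WeightedDigraph N) (δ δ' : ℝ) : ℝ :=
  min δ' ((1 - δ') * (δ / maxOutDegree G))

end Sequences

/-- The rate `1 - δ̃ / (4 N²)`. -/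
noncomputable def rate (N : ℕ) (δt : ℝ) : ℝ := 1 - δt / (4 * (N : ℝ) ^ 2)

/-- The constant `C_u = (2⁵ / 3²) / (1 - (1 - δ̃ / (4 N²)) ^ (1 / B))`. -/
noncomputable def constU (N B : ℕ) (δt : ℝ) : ℝ :=
  (2 ^ 5 / 3 ^ 2) / (1 - rate N δt ^ (1 / (B : ℝ)))

/-- The space `(ℝ^d)^N` with its Euclidean norm; `x i` is the `i`-th block of `x`. -/
abbrev Stack (N d : ℕ) : Type := PiLp 2 fun _ : Fin N => EuclideanSpace ℝ (Fin d)

/-- The action of the Kronecker product `M ⊗ I_d` on `(ℝ^d)^N`: the `i`-th block of the result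
is `∑ j, M i j • x j`. -/
noncomputable def kron {N d : ℕ} (M : Matrix (Fin N) (Fin N) ℝ) (x : Stack N d) : Stack N d :=
  WithLp.toLp 2 fun i => ∑ j, M i j • x j

/-- The matrix `L_K = I - (1/N) 𝟙 𝟙ᵀ`. -/
noncomputable def lapK (N : ℕ) : Matrix (Fin N) (Fin N) ℝ :=
  1 - (1 / (N : ℝ)) • Matrix.vecMulVec 1 1

/-- The nullspace of `L_K ⊗ I_d`. -/
def nullK (N d : ℕ) : Set (Stack N d) := {x | kron (lapK N) x = 0}

/-- The product `S^N × T^N` inside the Euclidean space `(ℝ^d)^N × (ℝ^e)^N`. -/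
def prodSet (N : ℕ) {d e : ℕ} (S : Set (EuclideanSpace ℝ (Fin d)))
    (T : Set (EuclideanSpace ℝ (Fin e))) : Set (WithLp 2 (Stack N d × Stack N e)) :=
  {p | (∀ i, p.fst i ∈ S) ∧ ∀ i, p.snd i ∈ T}

/-- `y` is an orthogonal projection of `x` onto `S`, that is, `y ∈ argmin_{z ∈ S} ‖x - z‖`. -/
def IsOrthProj {E : Type*} [NormedAddCommGroup E] (S : Set E) (x y : E) : Prop :=
  y ∈ S ∧ ∀ z ∈ S, ‖x - y‖ ≤ ‖x - z‖

/-- The projected Laplacian-averaging dynamics with disturbances `u₁`, `u₂`: for all `t ≥ 1`,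
`(D (t+1), Z (t+1))` is the orthogonal projection onto `S^N × T^N` of
`(D t - σ L_t D t + u₁ t, Z t - σ L_t Z t + u₂ t)`. Entries at time `0` play no role. -/
def IsTrajectory {N d e : ℕ} (G : ℕ → WeightedDigraph N) (σ : ℝ)
    (S : Set (EuclideanSpace ℝ (Fin d))) (T : Set (EuclideanSpace ℝ (Fin e)))
    (u₁ D : ℕ → Stack N d) (u₂ Z : ℕ → Stack N e) : Prop :=
  ∀ t, 1 ≤ t → IsOrthProj (prodSet N S T)
    (WithLp.toLp 2 (D t - σ • kron (G t).laplacian (D t) + u₁ t,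
      Z t - σ • kron (G t).laplacian (Z t) + u₂ t))
    (WithLp.toLp 2 (D (t + 1), Z (t + 1)))

/-- The maximum of `‖u s‖` over `1 ≤ s ≤ t - 1`, equal to `0` if there is no such `s`. -/
noncomputable def maxNorm {E : Type*} [SeminormedAddGroup E] (u : ℕ → E) (t : ℕ) : ℝ≥0 :=
  (Finset.Icc 1 (t - 1)).sup fun s => ‖u s‖₊

/-- Class `K` functions. -/
def ClassK (γ : ℝ≥0 → ℝ≥0) : Prop := Continuous γ ∧ StrictMono γ ∧ γ 0 = 0

/-- Class `KL` functions. -/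
def ClassKL (β : ℝ≥0 → ℝ≥0 → ℝ≥0) : Prop :=
  (∀ s, ClassK fun r => β r s) ∧
    ∀ r, Antitone (β r) ∧ Filter.Tendsto (β r) Filter.atTop (nhds 0)

/-- Input-to-state stability, with respect to the set `A`, of a discrete-time dynamics with
initial time `1`. Here `Traj u x` says that `x` is a solution with input `u`. -/
def IsISS {E F : Type*} [NormedAddCommGroup E] [NormedAddCommGroup F]
    (Traj : (ℕ → F) → (ℕ → E) → Prop) (A : Set E) : Prop :=
  ∃ β γ, ClassKL β ∧ ClassK γ ∧ ∀ u x, Traj u x → ∀ t : ℕ, 1 ≤ t →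
    Metric.infDist (x t) A ≤
      β (Metric.infDist (x 1) A).toNNReal ((t - 1 : ℕ) : ℝ≥0) + γ (maxNorm u t)

end LaplacianAveraging

open LaplacianAveraging

/-! Put `W_t = I - σ L_t` and `η = δ̃`. The range of `σ` and weight balance make `W_t` doubly
stochastic, with diagonal entries and nonzero off-diagonal entries at least `η`; by joint
connectivity every cut of the vertex set is linked in each window of length `B`.

Undisturbed averaging multiplies the sum of squared deviations from the mean by at most `1 -
η/(2N²)` over a window (`dispersion_window`). Indeed, sort the values at its start. The gap at a cut
survives until the cut is first crossed, and that crossing lowers the dispersion by at least `η/2`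
times the squared gap; the squared gaps add up to at least the dispersion over `N²`. Square roots
give `rate`, and `decay_of_windows` gives geometric decay from any starting time at the price of a
factor `16/9`.

The projection counts as a further disturbance: if `D t` lies in `S^N`, so does its average, so the
total perturbation is at most `2‖u t‖`. As `D 1` may lie outside `S^N`, the first step instead uses
`IsOrthProj.disagreement_le`. Variation of constants then yields `disagreement_le_sum`, a geometric
convolution of the inputs; bounding it by the maximal input or summing it over time gives the two
estimates, and `isISS_nullK` gives stability. -/

namespace LaplacianAveraging

/-! ### Decrease of the dispersion under doubly stochastic averaging. -/

section Scalar

open Finset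

variable {N : ℕ}

/-- The sum of the squared deviations of `v` from its mean. -/
noncomputable def dispersion (v : Fin N → ℝ) : ℝ := ∑ i, (v i - (∑ j, v j) / N) ^ 2

theorem dispersion_nonneg (v : Fin N → ℝ) : 0 ≤ dispersion v :=
  sum_nonneg fun _ _ => sq_nonneg _

theorem dispersion_eq (hN : 1 ≤ N) (v : Fin N → ℝ) :
    dispersion v = ∑ i, v i ^ 2 - (∑ j, v j) ^ 2 / N := by
  have hN' : (N : ℝ) ≠ 0 := by positivity
  have h : ∀ i, (v i - (∑ j, v j) / N) ^ 2 =
      v i ^ 2 - 2 * ((∑ j, v j) / N) * v i + ((∑ j, v j) / N) ^ 2 := fun i => by ring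
  unfold dispersion
  simp_rw [h, sum_add_distrib, sum_sub_distrib, ← mul_sum]
  simp only [sum_const, card_univ, Fintype.card_fin, nsmul_eq_mul]
  field_simp
  ring

theorem dispersion_le_sum_sq (hN : 1 ≤ N) (v : Fin N → ℝ) : dispersion v ≤ ∑ i, v i ^ 2 := by
  rw [dispersion_eq hN]
  have : 0 ≤ (∑ j, v j) ^ 2 / (N : ℝ) := by positivity
  linarith

/-- Doubly stochastic matrices with diagonal entries at least `η`. -/
structure IsAveraging (η : ℝ) (W : Matrix (Fin N) (Fin N) ℝ) : Prop where
  nonneg : ∀ i j, 0 ≤ W i j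
  row : ∀ i, ∑ j, W i j = 1
  col : ∀ j, ∑ i, W i j = 1
  diag : ∀ i, η ≤ W i i

namespace IsAveraging

variable {η : ℝ} {W : Matrix (Fin N) (Fin N) ℝ}

theorem sum_mulVec (hW : IsAveraging η W) (v : Fin N → ℝ) : ∑ i, W.mulVec v i = ∑ i, v i := by
  simp only [Matrix.mulVec, dotProduct]
  rw [sum_comm]
  simp_rw [← sum_mul, hW.col, one_mul]

/-- The term of row `k` is the variance of `v` under the weights `W k ·`. Unit column sums recombine
the second moments, and the mean is preserved. -/
theorem dispersion_sub (hN : 1 ≤ N) (hW : IsAveraging η W) (v : Fin N → ℝ) :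
    dispersion v - dispersion (W.mulVec v) =
      ∑ k, 1 / 2 * ∑ i, ∑ j, W k i * W k j * (v i - v j) ^ 2 := by
  rw [dispersion_eq hN, dispersion_eq hN, hW.sum_mulVec]
  have hrow : ∀ k, 1 / 2 * ∑ i, ∑ j, W k i * W k j * (v i - v j) ^ 2 =
      ∑ i, W k i * v i ^ 2 - W.mulVec v k ^ 2 := by
    intro k
    have h : ∀ i j, W k i * W k j * (v i - v j) ^ 2 =
        (W k i * v i ^ 2) * W k j + W k i * (W k j * v j ^ 2) -
          2 * ((W k i * v i) * (W k j * v j)) := fun i j => by ring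
    simp_rw [h, sum_sub_distrib, sum_add_distrib, ← mul_sum, ← sum_mul, hW.row]
    simp only [Matrix.mulVec, dotProduct]
    ring
  simp_rw [hrow, sum_sub_distrib]
  rw [sum_comm]
  simp_rw [← sum_mul, hW.col]
  simp only [one_mul]
  ring

theorem dispersion_mulVec_le (hN : 1 ≤ N) (hW : IsAveraging η W) (v : Fin N → ℝ) :
    dispersion (W.mulVec v) ≤ dispersion v := by
  have h := hW.dispersion_sub hN v
  have : 0 ≤ ∑ k, 1 / 2 * ∑ i, ∑ j, W k i * W k j * (v i - v j) ^ 2 :=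
    sum_nonneg fun k _ => mul_nonneg (by norm_num) <| sum_nonneg fun i _ => sum_nonneg fun j _ =>
      mul_nonneg (mul_nonneg (hW.nonneg _ _) (hW.nonneg _ _)) (sq_nonneg _)
  linarith

end IsAveraging

/-- The values `v i` with `r i ≤ d` are at most `h d`, the others at least `h (d + 1)`. -/
def Separates (r : Fin N → ℕ) (h : ℕ → ℝ) (v : Fin N → ℝ) (d : ℕ) : Prop :=
  (∀ i, r i ≤ d → v i ≤ h d) ∧ ∀ i, d < r i → h (d + 1) ≤ v i

/-- A weight at least `η` links the vertices with `r i ≤ d` to the others. -/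
def Crosses (η : ℝ) (W : Matrix (Fin N) (Fin N) ℝ) (r : Fin N → ℕ) (d : ℕ) : Prop :=
  ∃ k j, (r k ≤ d ↔ d < r j) ∧ η ≤ W k j

/-- The gaps between `i` and `j` are nonnegative and add up to at most `v j - v i`; the square of
their sum dominates the sum of their squares. -/
theorem sum_sq_gaps_le {r : Fin N → ℕ} {h : ℕ → ℝ} (hh : Monotone h) {v : Fin N → ℝ}
    {D : Finset ℕ} (hD : ∀ d ∈ D, Separates r h v d) (i j : Fin N) :
    ∑ d ∈ D with r i ≤ d ∧ d < r j, (h (d + 1) - h d) ^ 2 ≤ (v i - v j) ^ 2 := by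
  have hg : ∀ d, 0 ≤ h (d + 1) - h d := fun d => sub_nonneg.2 (hh d.le_succ)
  set F := D.filter fun d => r i ≤ d ∧ d < r j with hF
  rcases F.eq_empty_or_nonempty with he | hne
  · rw [he, sum_empty]; positivity
  have hm := mem_filter.1 (F.min'_mem hne)
  have hM := mem_filter.1 (F.max'_mem hne)
  have h1 : v i ≤ h (F.min' hne) := (hD _ hm.1).1 i hm.2.1
  have h2 : h (F.max' hne + 1) ≤ v j := (hD _ hM.1).2 j hM.2.2
  have h3 : ∑ d ∈ F, (h (d + 1) - h d) ≤ h (F.max' hne + 1) - h (F.min' hne) := by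
    have hle : F.min' hne ≤ F.max' hne + 1 := (F.min'_le _ (F.max'_mem hne)).trans (Nat.le_succ _)
    rw [← sum_Ico_sub h hle]
    refine sum_le_sum_of_subset_of_nonneg (fun d hd => ?_) fun d _ _ => hg d
    exact mem_Ico.2 ⟨F.min'_le _ hd, Nat.lt_succ_of_le (F.le_max' _ hd)⟩
  calc ∑ d ∈ F, (h (d + 1) - h d) ^ 2 ≤ (∑ d ∈ F, (h (d + 1) - h d)) ^ 2 :=
        sum_sq_le_sq_sum_of_nonneg fun d _ => hg d
    _ ≤ (v j - v i) ^ 2 := pow_le_pow_left₀ (sum_nonneg fun d _ => hg d) (by linarith) 2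
    _ = (v i - v j) ^ 2 := by ring

/-- Symmetric form, fit for the double sum in `dispersion_sub`; only the indicator product matching
the order of `r i` and `r j` can be nonzero. -/
theorem sum_sq_gaps_mul_le {r : Fin N → ℕ} {h : ℕ → ℝ} (hh : Monotone h) {v : Fin N → ℝ}
    {D : Finset ℕ} (hD : ∀ d ∈ D, Separates r h v d) (i j : Fin N) :
    ∑ d ∈ D, (h (d + 1) - h d) ^ 2 *
        ((if r i ≤ d then 1 else 0) * (if d < r j then 1 else 0) +
          (if d < r i then 1 else 0) * (if r j ≤ d then 1 else 0)) ≤ (v i - v j) ^ 2 := by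
  rcases le_total (r i) (r j) with hij | hij
  · refine le_trans (le_of_eq ?_) (sum_sq_gaps_le hh hD i j)
    rw [sum_filter]
    refine sum_congr rfl fun d _ => ?_
    split_ifs <;> first | omega | simp
  · refine le_trans (le_of_eq ?_)
      ((sum_sq_gaps_le hh hD j i).trans_eq (sub_sq_comm _ _))
    rw [sum_filter]
    refine sum_congr rfl fun d _ => ?_
    split_ifs <;> first | omega | simp

/-- Row `k` has weight at least `η` on both sides of the cut: the diagonal entry on its own side, `W
k j` on the other. -/
theorem IsAveraging.cut_mass {η : ℝ} (hη : 0 ≤ η) {W : Matrix (Fin N) (Fin N) ℝ}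
    (hW : IsAveraging η W) {r : Fin N → ℕ} {d : ℕ} {k j : Fin N} (hkj : r k ≤ d ↔ d < r j)
    (hj : η ≤ W k j) :
    η / 2 ≤ (∑ i, W k i * if r i ≤ d then 1 else 0) * ∑ i, W k i * if d < r i then 1 else 0 := by
  set a := ∑ i, W k i * if r i ≤ d then (1 : ℝ) else 0 with ha
  set b := ∑ i, W k i * if d < r i then (1 : ℝ) else 0 with hb
  have hab : a + b = 1 := by
    rw [ha, hb, ← sum_add_distrib]
    refine (sum_congr rfl fun i _ => ?_).trans (hW.row k)
    split_ifs <;> first | omega | simp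
  have hna : ∀ i, 0 ≤ W k i * if r i ≤ d then (1 : ℝ) else 0 := fun i =>
    mul_nonneg (hW.nonneg _ _) (by split_ifs <;> norm_num)
  have hnb : ∀ i, 0 ≤ W k i * if d < r i then (1 : ℝ) else 0 := fun i =>
    mul_nonneg (hW.nonneg _ _) (by split_ifs <;> norm_num)
  have hla : ∀ i, r i ≤ d → W k i ≤ a := fun i hi => by
    have := single_le_sum (fun i _ => hna i) (mem_univ i)
    rwa [if_pos hi, mul_one] at this
  have hlb : ∀ i, d < r i → W k i ≤ b := fun i hi => by
    have := single_le_sum (fun i _ => hnb i) (mem_univ i)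
    rwa [if_pos hi, mul_one] at this
  have hd := hW.diag k
  have key : η ≤ a ∧ η ≤ b := by
    by_cases hk : r k ≤ d
    · exact ⟨hd.trans (hla k hk), hj.trans (hlb j (hkj.1 hk))⟩
    · exact ⟨hj.trans (hla j (not_lt.1 fun h => hk (hkj.2 h))), hd.trans (hlb k (not_le.1 hk))⟩
  -- This gives `a b ≥ η - η²`, and `2 η ≤ a + b = 1` makes it at least `η / 2`.
  nlinarith [mul_nonneg (sub_nonneg.2 key.1) (sub_nonneg.2 key.2)]

/-- All crossed cuts count at once: in row `k` each cut contributes its squared gap times the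
product of the masses on its two sides, and one crossing row per cut suffices. -/
theorem IsAveraging.dispersion_step {η : ℝ} (hη : 0 ≤ η) (hN : 1 ≤ N)
    {W : Matrix (Fin N) (Fin N) ℝ} (hW : IsAveraging η W) {r : Fin N → ℕ} {h : ℕ → ℝ}
    (hh : Monotone h) {v : Fin N → ℝ} {D : Finset ℕ} (hD : ∀ d ∈ D, Separates r h v d)
    (hc : ∀ d ∈ D, Crosses η W r d) :
    dispersion (W.mulVec v) + η / 2 * ∑ d ∈ D, (h (d + 1) - h d) ^ 2 ≤ dispersion v := by
  have hsub := hW.dispersion_sub hN v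
  suffices hs : η / 2 * ∑ d ∈ D, (h (d + 1) - h d) ^ 2 ≤
      ∑ k, 1 / 2 * ∑ i, ∑ j, W k i * W k j * (v i - v j) ^ 2 by linarith
  have hrow : ∀ k, ∑ d ∈ D, (h (d + 1) - h d) ^ 2 *
      ((∑ i, W k i * if r i ≤ d then 1 else 0) * ∑ i, W k i * if d < r i then 1 else 0) ≤
      1 / 2 * ∑ i, ∑ j, W k i * W k j * (v i - v j) ^ 2 := by
    intro k
    have hle : ∑ i, ∑ j, W k i * W k j * (∑ d ∈ D, (h (d + 1) - h d) ^ 2 *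
        ((if r i ≤ d then 1 else 0) * (if d < r j then 1 else 0) +
          (if d < r i then 1 else 0) * (if r j ≤ d then 1 else 0))) ≤
        ∑ i, ∑ j, W k i * W k j * (v i - v j) ^ 2 :=
      sum_le_sum fun i _ => sum_le_sum fun j _ =>
        mul_le_mul_of_nonneg_left (sum_sq_gaps_mul_le hh hD i j)
          (mul_nonneg (hW.nonneg _ _) (hW.nonneg _ _))
    have heq : ∑ i, ∑ j, W k i * W k j * (∑ d ∈ D, (h (d + 1) - h d) ^ 2 *
        ((if r i ≤ d then 1 else 0) * (if d < r j then 1 else 0) +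
          (if d < r i then 1 else 0) * (if r j ≤ d then 1 else 0))) =
        2 * ∑ d ∈ D, (h (d + 1) - h d) ^ 2 *
          ((∑ i, W k i * if r i ≤ d then 1 else 0) *
            ∑ i, W k i * if d < r i then 1 else 0) := by
      simp_rw [mul_sum]
      rw [sum_congr rfl fun i _ => sum_comm, sum_comm]
      refine sum_congr rfl fun d _ => ?_
      have he : ∀ i j, W k i * W k j * ((h (d + 1) - h d) ^ 2 *
          ((if r i ≤ d then 1 else 0) * (if d < r j then 1 else 0) +
          (if d < r i then 1 else 0) * (if r j ≤ d then 1 else 0))) =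
          (h (d + 1) - h d) ^ 2 * ((W k i * if r i ≤ d then 1 else 0) *
            (W k j * if d < r j then 1 else 0)) +
          (h (d + 1) - h d) ^ 2 * ((W k i * if d < r i then 1 else 0) *
            (W k j * if r j ≤ d then 1 else 0)) := fun i j => by
        split_ifs <;> ring
      simp_rw [he, sum_add_distrib, ← mul_sum, ← sum_mul]
      ring
    linarith
  have hn : ∀ k d, 0 ≤ (∑ i, W k i * if r i ≤ d then (1 : ℝ) else 0) *
      ∑ i, W k i * if d < r i then (1 : ℝ) else 0 := fun k d =>
    mul_nonneg
      (sum_nonneg fun i _ => mul_nonneg (hW.nonneg _ _) (by split_ifs <;> norm_num))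
      (sum_nonneg fun i _ => mul_nonneg (hW.nonneg _ _) (by split_ifs <;> norm_num))
  refine le_trans ?_ (sum_le_sum fun k _ => hrow k)
  rw [sum_comm, mul_sum]
  refine sum_le_sum fun d hd => ?_
  rw [← mul_sum, mul_comm]
  refine mul_le_mul_of_nonneg_left ?_ (sq_nonneg _)
  obtain ⟨k, j, hkj, hj⟩ := hc d hd
  exact (hW.cut_mass hη hkj hj).trans (single_le_sum (fun k _ => hn k d) (mem_univ k))

/-- If no weight links the two sides of a cut, averaging preserves the separation. -/
theorem IsAveraging.separates {η : ℝ} {W : Matrix (Fin N) (Fin N) ℝ}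
    (hW : IsAveraging η W) {r : Fin N → ℕ} {h : ℕ → ℝ} {v : Fin N → ℝ} {d : ℕ}
    (hpos : ∀ i j, i ≠ j → 0 < W i j → η ≤ W i j) (hc : ¬ Crosses η W r d)
    (hs : Separates r h v d) : Separates r h (W.mulVec v) d := by
  have hz : ∀ i j, (r i ≤ d ↔ d < r j) → W i j = 0 := fun i j hij => by
    have hne : i ≠ j := by rintro rfl; omega
    refine le_antisymm (not_lt.1 fun hlt => hc ⟨i, j, hij, hpos i j hne hlt⟩) (hW.nonneg i j)
  constructor
  · intro i hi
    calc ∑ j, W i j * v j ≤ ∑ j, W i j * h d := by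
          refine sum_le_sum fun j _ => ?_
          by_cases hj : r j ≤ d
          · exact mul_le_mul_of_nonneg_left (hs.1 j hj) (hW.nonneg i j)
          · rw [hz i j (by omega), zero_mul, zero_mul]
      _ = h d := by rw [← sum_mul, hW.row, one_mul]
  · intro i hi
    calc h (d + 1) = ∑ j, W i j * h (d + 1) := by rw [← sum_mul, hW.row, one_mul]
      _ ≤ ∑ j, W i j * v j := by
          refine sum_le_sum fun j _ => ?_
          by_cases hj : r j ≤ d
          · rw [hz i j (by omega), zero_mul, zero_mul]
          · exact mul_le_mul_of_nonneg_left (hs.2 j (not_le.1 hj)) (hW.nonneg i j)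

theorem exists_rank (hN : 1 ≤ N) (v : Fin N → ℝ) :
    ∃ (r : Fin N → ℕ) (h : ℕ → ℝ), Monotone h ∧ (∀ i, r i < N) ∧ (∀ i, v i = h (r i)) ∧
      (∀ d < N, ∃ i, r i = d) := by
  have hlt : ∀ m : ℕ, min m (N - 1) < N := fun m => by omega
  -- `r` is the position in sorted order; `h` lists the sorted values and stays constant from `N -
  -- 1` on, hence is monotone on `ℕ`.
  refine ⟨fun i => ((Tuple.sort v).symm i : ℕ), fun m => v (Tuple.sort v ⟨min m (N - 1), hlt m⟩),
    fun a b hab => ?_, fun i => Fin.is_lt _, fun i => ?_, fun d hd => ?_⟩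
  · exact Tuple.monotone_sort v (show (⟨_, _⟩ : Fin N) ≤ ⟨_, _⟩ from
      Fin.mk_le_mk.2 (min_le_min_right _ hab))
  · have : (⟨min ((Tuple.sort v).symm i : ℕ) (N - 1), hlt _⟩ : Fin N) = (Tuple.sort v).symm i :=
      Fin.ext (min_eq_left (by have := ((Tuple.sort v).symm i).is_lt; omega))
    simp only [this, Equiv.apply_symm_apply]
  · exact ⟨Tuple.sort v ⟨d, hd⟩, by simp⟩

/-- Bounding each of the `N` deviations by the range costs one factor `N`; Cauchy–Schwarz over the
`N - 1` gaps costs the other. -/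
theorem dispersion_le_gaps (hN : 1 ≤ N) {r : Fin N → ℕ} {h : ℕ → ℝ} (hh : Monotone h)
    {v : Fin N → ℝ} (hr : ∀ i, r i < N) (hv : ∀ i, v i = h (r i)) :
    dispersion v ≤ N ^ 2 * ∑ d ∈ range (N - 1), (h (d + 1) - h d) ^ 2 := by
  have hN' : (0 : ℝ) < N := by positivity
  have hlo : ∀ i, h 0 ≤ v i := fun i => (hv i).symm ▸ hh (Nat.zero_le _)
  have hhi : ∀ i, v i ≤ h (N - 1) := fun i => (hv i).symm ▸ hh (by have := hr i; omega)
  have hml : h 0 ≤ (∑ j, v j) / N := by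
    rw [le_div_iff₀ hN', mul_comm]
    simpa using card_nsmul_le_sum univ v (h 0) fun i _ => hlo i
  have hmh : (∑ j, v j) / N ≤ h (N - 1) := by
    rw [div_le_iff₀ hN', mul_comm]
    simpa using sum_le_card_nsmul univ v (h (N - 1)) fun i _ => hhi i
  have h1 : dispersion v ≤ N * (h (N - 1) - h 0) ^ 2 := by
    have := sum_le_card_nsmul univ (fun i => (v i - (∑ j, v j) / N) ^ 2)
      ((h (N - 1) - h 0) ^ 2) fun i _ => sq_le_sq' (by linarith [hlo i]) (by linarith [hhi i])
    simpa [dispersion] using this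
  have h2 : (h (N - 1) - h 0) ^ 2 ≤ N * ∑ d ∈ range (N - 1), (h (d + 1) - h d) ^ 2 := by
    rw [← sum_range_sub]
    refine (sq_sum_le_card_mul_sum_sq).trans ?_
    refine mul_le_mul_of_nonneg_right ?_ (sum_nonneg fun _ _ => sq_nonneg _)
    rw [card_range]
    exact_mod_cast Nat.sub_le _ _
  calc dispersion v ≤ N * (h (N - 1) - h 0) ^ 2 := h1
    _ ≤ N * (N * ∑ d ∈ range (N - 1), (h (d + 1) - h d) ^ 2) :=
        mul_le_mul_of_nonneg_left h2 hN'.le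
    _ = _ := by ring

/-- Contraction of the dispersion over a window in which every cut is crossed. -/
theorem dispersion_window {η : ℝ} (hη : 0 ≤ η) (hN : 1 ≤ N) {B : ℕ}
    {W : ℕ → Matrix (Fin N) (Fin N) ℝ} {x : ℕ → Fin N → ℝ}
    (hW : ∀ t < B, IsAveraging η (W t))
    (hpos : ∀ t < B, ∀ i j, i ≠ j → 0 < W t i j → η ≤ W t i j)
    (hconn : ∀ A : Set (Fin N), A.Nonempty → Aᶜ.Nonempty →
      ∃ t < B, ∃ i ∈ A, ∃ j ∈ Aᶜ, η ≤ W t i j)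
    (hx : ∀ t < B, x (t + 1) = (W t).mulVec (x t)) :
    dispersion (x B) ≤ (1 - η / (2 * N ^ 2)) * dispersion (x 0) := by
  classical
  obtain ⟨r, h, hh, hr, hv, hsurj⟩ := exists_rank hN (x 0)
  -- The cuts first crossed at time `t`: their initial gaps are still intact, and no cut is counted
  -- twice.
  let D : ℕ → Finset ℕ := fun t =>
    (range (N - 1)).filter fun d => Crosses η (W t) r d ∧ ∀ s < t, ¬ Crosses η (W s) r d
  have hsep : ∀ d t, t ≤ B → (∀ s < t, ¬ Crosses η (W s) r d) → Separates r h (x t) d := by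
    intro d t
    induction t with
    | zero =>
      exact fun _ _ => ⟨fun i hi => hv i ▸ hh hi, fun i hi => hv i ▸ hh hi⟩
    | succ t ih =>
      intro ht hs
      rw [hx t ht]
      exact (hW t ht).separates (hpos t ht) (hs t t.lt_succ_self)
        (ih (by omega) fun s hst => hs s (by omega))
  have hsum : ∀ t ≤ B, dispersion (x t) +
      η / 2 * ∑ s ∈ range t, ∑ d ∈ D s, (h (d + 1) - h d) ^ 2 ≤ dispersion (x 0) := by
    intro t
    induction t with
    | zero => intro _; simp
    | succ t ih =>
      intro ht
      have h1 := ih (by omega)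
      have h2 := (hW t ht).dispersion_step hη hN hh (v := x t) (D := D t)
        (fun d hd => hsep d t (by omega) (mem_filter.1 hd).2.2) fun d hd => (mem_filter.1 hd).2.1
      rw [sum_range_succ, mul_add, hx t ht]
      linarith
  have hcover : ∑ d ∈ range (N - 1), (h (d + 1) - h d) ^ 2 ≤
      ∑ s ∈ range B, ∑ d ∈ D s, (h (d + 1) - h d) ^ 2 := by
    have : range (N - 1) ⊆ (range B).biUnion D := by
      intro d hd
      have hd' := mem_range.1 hd
      obtain ⟨i₀, hi₀⟩ := hsurj d (by omega)
      obtain ⟨j₀, hj₀⟩ := hsurj (d + 1) (by omega)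
      obtain ⟨t, ht, i, hi, j, hj, hij⟩ := hconn {i | r i ≤ d} ⟨i₀, hi₀.le⟩
        ⟨j₀, fun hle => by have : r j₀ ≤ d := hle; omega⟩
      have hex : ∃ t, Crosses η (W t) r d := ⟨t, i, j, ⟨fun _ => not_le.1 hj, fun _ => hi⟩, hij⟩
      refine mem_biUnion.2 ⟨Nat.find hex, mem_range.2 ((Nat.find_min' hex
        ⟨i, j, ⟨fun _ => not_le.1 hj, fun _ => hi⟩, hij⟩).trans_lt ht), mem_filter.2
        ⟨hd, Nat.find_spec hex, fun s hs => Nat.find_min hex hs⟩⟩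
    refine (sum_le_sum_of_subset_of_nonneg this fun _ _ _ => sq_nonneg _).trans ?_
    refine (sum_biUnion fun s _ t _ hst => ?_).le
    refine disjoint_left.2 fun d hs ht => ?_
    rcases lt_or_gt_of_ne hst with hlt | hlt
    · exact (mem_filter.1 ht).2.2 s hlt (mem_filter.1 hs).2.1
    · exact (mem_filter.1 hs).2.2 t hlt (mem_filter.1 ht).2.1
  have hg := dispersion_le_gaps hN hh hr hv
  have hN' : (0 : ℝ) < N := by positivity
  have h3 : η / (2 * N ^ 2) * dispersion (x 0) ≤
      η / 2 * ∑ s ∈ range B, ∑ d ∈ D s, (h (d + 1) - h d) ^ 2 := by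
    calc η / (2 * N ^ 2) * dispersion (x 0)
        ≤ η / (2 * N ^ 2) * (N ^ 2 * ∑ s ∈ range B, ∑ d ∈ D s, (h (d + 1) - h d) ^ 2) :=
          mul_le_mul_of_nonneg_left
            (hg.trans (mul_le_mul_of_nonneg_left hcover (by positivity))) (by positivity)
      _ = _ := by field_simp
  linarith [hsum B le_rfl]

end Scalar

/-! ### Disagreement of stacks of vectors, coordinate by coordinate. -/

section Stacks

open Finset

variable {N d : ℕ}

/-- The vector of the `c`-th coordinates of the blocks of `x`. -/
def coord (x : Stack N d) (c : Fin d) : Fin N → ℝ := fun i => x i c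

theorem coord_kron (M : Matrix (Fin N) (Fin N) ℝ) (x : Stack N d) (c : Fin d) :
    coord (kron M x) c = M.mulVec (coord x c) := by
  funext i
  simp [coord, kron, Matrix.mulVec, dotProduct]

theorem stack_ext {x y : Stack N d} (h : ∀ c, coord x c = coord y c) : x = y := by
  ext i c
  exact congrFun (h c) i

theorem norm_sq_stack (x : Stack N d) : ‖x‖ ^ 2 = ∑ c, ∑ i, coord x c i ^ 2 := by
  rw [PiLp.norm_sq_eq_of_L2, sum_comm]
  refine sum_congr rfl fun i _ => ?_
  rw [EuclideanSpace.norm_sq_eq]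
  simp [coord]

theorem kron_add (M : Matrix (Fin N) (Fin N) ℝ) (x y : Stack N d) :
    kron M (x + y) = kron M x + kron M y :=
  stack_ext fun c => by
    simp only [coord_kron]
    exact Matrix.mulVec_add M (coord x c) (coord y c) |>.trans
      (by rw [← coord_kron, ← coord_kron]; rfl)

theorem kron_sub (M : Matrix (Fin N) (Fin N) ℝ) (x y : Stack N d) :
    kron M (x - y) = kron M x - kron M y :=
  eq_sub_of_add_eq (by rw [← kron_add, sub_add_cancel])

theorem kron_sum {ι : Type*} (M : Matrix (Fin N) (Fin N) ℝ) (s : Finset ι) (f : ι → Stack N d) :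
    kron M (∑ i ∈ s, f i) = ∑ i ∈ s, kron M (f i) :=
  map_sum (AddMonoidHom.mk' (kron M) (kron_add M)) f s

theorem lapK_mulVec (v : Fin N → ℝ) (i : Fin N) :
    (lapK N).mulVec v i = v i - (∑ j, v j) / N := by
  simp only [lapK, Matrix.sub_mulVec, Matrix.one_mulVec, Matrix.smul_mulVec, Pi.sub_apply,
    Pi.smul_apply, smul_eq_mul]
  simp [Matrix.mulVec, dotProduct, Matrix.vecMulVec_apply]
  ring

/-- The norm of the disagreement. -/
noncomputable def disagreement (x : Stack N d) : ℝ := ‖kron (lapK N) x‖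

theorem disagreement_nonneg (x : Stack N d) : 0 ≤ disagreement x := norm_nonneg _

theorem disagreement_sq (x : Stack N d) :
    disagreement x ^ 2 = ∑ c, dispersion (coord x c) := by
  rw [disagreement, norm_sq_stack]
  refine sum_congr rfl fun c _ => ?_
  rw [coord_kron]
  simp_rw [lapK_mulVec]
  rfl

theorem disagreement_add_le (x y : Stack N d) :
    disagreement (x + y) ≤ disagreement x + disagreement y := by
  rw [disagreement, kron_add]
  exact norm_add_le _ _

theorem disagreement_sum_le {ι : Type*} (s : Finset ι) (f : ι → Stack N d) :
    disagreement (∑ i ∈ s, f i) ≤ ∑ i ∈ s, disagreement (f i) := by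
  rw [disagreement, kron_sum]
  exact norm_sum_le _ _

theorem disagreement_le_norm (hN : 1 ≤ N) (x : Stack N d) : disagreement x ≤ ‖x‖ := by
  refine le_of_sq_le_sq ?_ (norm_nonneg _)
  rw [disagreement_sq, norm_sq_stack]
  exact sum_le_sum fun c _ => dispersion_le_sum_sq hN _

theorem disagreement_kron_le (hN : 1 ≤ N) {η : ℝ} {W : Matrix (Fin N) (Fin N) ℝ}
    (hW : IsAveraging η W) (x : Stack N d) : disagreement (kron W x) ≤ disagreement x := by
  refine le_of_sq_le_sq ?_ (norm_nonneg _)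
  rw [disagreement_sq, disagreement_sq]
  refine sum_le_sum fun c _ => ?_
  rw [coord_kron]
  exact hW.dispersion_mulVec_le hN _

theorem disagreement_window {η : ℝ} (hη : 0 ≤ η) (hη1 : η ≤ 1) (hN : 1 ≤ N) {B : ℕ}
    {W : ℕ → Matrix (Fin N) (Fin N) ℝ} {x : ℕ → Stack N d}
    (hW : ∀ t < B, IsAveraging η (W t))
    (hpos : ∀ t < B, ∀ i j, i ≠ j → 0 < W t i j → η ≤ W t i j)
    (hconn : ∀ A : Set (Fin N), A.Nonempty → Aᶜ.Nonempty →
      ∃ t < B, ∃ i ∈ A, ∃ j ∈ Aᶜ, η ≤ W t i j)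
    (hx : ∀ t < B, x (t + 1) = kron (W t) (x t)) :
    disagreement (x B) ≤ rate N η * disagreement (x 0) := by
  have hN' : (1 : ℝ) ≤ N := by exact_mod_cast hN
  have hle : η / (4 * (N : ℝ) ^ 2) ≤ 1 := by
    rw [div_le_one (by positivity)]
    nlinarith
  refine le_of_sq_le_sq ?_ (mul_nonneg (sub_nonneg.2 hle) (norm_nonneg _))
  rw [mul_pow, disagreement_sq, disagreement_sq, mul_sum]
  refine sum_le_sum fun c _ => ?_
  refine (dispersion_window hη hN (x := fun t => coord (x t) c) hW hpos hconn
    fun t ht => by rw [hx t ht, coord_kron]).trans ?_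
  refine mul_le_mul_of_nonneg_right ?_ (dispersion_nonneg _)
  -- The positive square term is what lets `rate` replace the square root of `1 - η / (2 N²)`.
  have : rate N η ^ 2 = 1 - η / (2 * N ^ 2) + (η / (4 * (N : ℝ) ^ 2)) ^ 2 := by
    unfold rate
    field_simp
    ring
  rw [this]
  linarith [sq_nonneg (η / (4 * (N : ℝ) ^ 2))]

/-- The undisturbed averaging, started from `x` at time `s` and run for `n` steps. -/
noncomputable def evolve (W : ℕ → Matrix (Fin N) (Fin N) ℝ) (s : ℕ) (x : Stack N d) :
    ℕ → Stack N d
  | 0 => x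
  | n + 1 => kron (W (s + n)) (evolve W s x n)

/-- Variation of constants: the input `w (s + i)` enters the state at time `s + i + 1` and then
evolves for `n - 1 - i` steps. -/
theorem eq_evolve_add_sum {W : ℕ → Matrix (Fin N) (Fin N) ℝ} {s : ℕ} {X w : ℕ → Stack N d}
    (hX : ∀ t, s ≤ t → X (t + 1) = kron (W t) (X t) + w t) (n : ℕ) :
    X (s + n) = evolve W s (X s) n +
      ∑ i ∈ range n, evolve W (s + i + 1) (w (s + i)) (n - 1 - i) := by
  induction n with
  | zero => simp [evolve]
  | succ n ih =>
    rw [← add_assoc, hX _ (Nat.le_add_right s n), ih, kron_add, kron_sum, sum_range_succ,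
      ← add_assoc, evolve]
    congr 1
    · congr 1
      refine sum_congr rfl fun i hi => ?_
      have hi' := mem_range.1 hi
      obtain ⟨m, rfl⟩ : ∃ m, n = i + 1 + m := ⟨n - (i + 1), by omega⟩
      rw [show i + 1 + m + 1 - 1 - i = m + 1 by omega, show i + 1 + m - 1 - i = m by omega, evolve]
      congr 2
      omega
    · simp [evolve]

end Stacks

/-! ### From contraction over aligned windows to geometric decay. -/

section Rates

/-- A quantity that never increases, and shrinks by the factor `ρ` over every window
`[k B, (k + 1) B)`, decays geometrically. -/
theorem decay_of_windows {B : ℕ} (hB : 1 ≤ B) {ρ : ℝ} (hρ : 3 / 4 ≤ ρ) (hρ1 : ρ ≤ 1) {s : ℕ}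
    {f : ℕ → ℝ} (hf0 : ∀ n, 0 ≤ f n) (hf : Antitone f)
    (hw : ∀ k n, s + n = k * B → f (n + B) ≤ ρ * f n) (n : ℕ) :
    f n ≤ 16 / 9 * ρ ^ ⌈((n + 1 : ℕ) : ℝ) / B⌉₊ * f 0 := by
  have hρ0 : 0 ≤ ρ := by linarith
  have hB' : (0 : ℝ) < B := by exact_mod_cast hB
  set c := ⌈((n + 1 : ℕ) : ℝ) / B⌉₊ with hc
  -- Misalignment with the windows loses at most two factors `ρ`; since `ρ ≥ 3 / 4`, the constant
  -- `16 / 9` pays for them.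
  have h169 : 1 ≤ 16 / 9 * ρ ^ 2 := by nlinarith
  rcases le_or_gt c 2 with h2 | h2
  · have : ρ ^ 2 ≤ ρ ^ c := pow_le_pow_of_le_one hρ0 hρ1 h2
    calc f n ≤ 1 * f 0 := by rw [one_mul]; exact hf (Nat.zero_le n)
      _ ≤ _ := mul_le_mul_of_nonneg_right (by linarith) (hf0 0)
  · obtain ⟨m, hm⟩ : ∃ m, c = m + 2 := ⟨c - 2, by omega⟩
    have hlt : (m + 1) * B < n + 1 := by
      have : m + 1 < c := by omega
      rw [hc, Nat.lt_ceil, lt_div_iff₀ hB'] at this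
      exact_mod_cast this
    obtain ⟨n₀, k₀, hn₀, hk₀⟩ : ∃ n₀ k₀, n₀ < B ∧ s + n₀ = k₀ * B := by
      refine ⟨(B - s % B) % B, (s + (B - s % B) % B) / B, Nat.mod_lt _ hB, ?_⟩
      refine (Nat.div_mul_cancel (Nat.dvd_of_mod_eq_zero ?_)).symm
      have h1 := Nat.mod_lt s hB
      rw [Nat.add_mod, Nat.mod_mod]
      rcases Nat.eq_zero_or_pos (s % B) with h0 | h0
      · simp [h0]
      · rw [Nat.mod_eq_of_lt (show B - s % B < B by omega), show s % B + (B - s % B) = B by omega,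
          Nat.mod_self]
    have hiter : ∀ j, f (n₀ + j * B) ≤ ρ ^ j * f n₀ := by
      intro j
      induction j with
      | zero => simp
      | succ j ih =>
        have := hw (k₀ + j) (n₀ + j * B) (by rw [add_mul, ← hk₀]; ring)
        calc f (n₀ + (j + 1) * B) = f (n₀ + j * B + B) := by congr 1; ring
          _ ≤ ρ * f (n₀ + j * B) := this
          _ ≤ ρ * (ρ ^ j * f n₀) := mul_le_mul_of_nonneg_left ih hρ0
          _ = _ := by ring
    calc f n ≤ f (n₀ + m * B) := hf (by rw [add_mul] at hlt; omega)
      _ ≤ ρ ^ m * f n₀ := hiter m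
      _ ≤ ρ ^ m * f 0 := mul_le_mul_of_nonneg_left (hf (Nat.zero_le _)) (by positivity)
      _ ≤ (16 / 9 * ρ ^ 2) * (ρ ^ m * f 0) :=
          le_mul_of_one_le_left (mul_nonneg (by positivity) (hf0 0)) h169
      _ = _ := by rw [hm]; ring

theorem pow_ceil_div_le {B : ℕ} {ρ : ℝ} (hρ : 0 < ρ) (hρ1 : ρ ≤ 1) (n : ℕ) :
    ρ ^ ⌈(n : ℝ) / B⌉₊ ≤ (ρ ^ (1 / (B : ℝ))) ^ n := by
  rw [← Real.rpow_natCast, ← Real.rpow_natCast, ← Real.rpow_mul hρ.le]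
  refine Real.rpow_le_rpow_of_exponent_ge hρ hρ1 ?_
  rw [one_div, inv_mul_eq_div]
  exact Nat.le_ceil _

theorem pow_ceil_div_anti {B : ℕ} {ρ : ℝ} (hρ : 0 ≤ ρ) (hρ1 : ρ ≤ 1) {m n : ℕ} (h : m ≤ n) :
    ρ ^ ⌈(n : ℝ) / B⌉₊ ≤ ρ ^ ⌈(m : ℝ) / B⌉₊ :=
  pow_le_pow_of_le_one hρ hρ1 (Nat.ceil_mono (by gcongr))

end Rates

/-! ### Orthogonal projections and the consensus subspace. -/

section Projection

theorem IsOrthProj.inner_le_zero {E : Type*} [NormedAddCommGroup E] [InnerProductSpace ℝ E]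
    {K : Set E} (hK : Convex ℝ K) {x y : E} (h : IsOrthProj K x y) {z : E} (hz : z ∈ K) :
    inner ℝ (x - y) (z - y) ≤ 0 := by
  refine (norm_eq_iInf_iff_real_inner_le_zero hK h.1).1 ?_ z hz
  have : Nonempty K := ⟨⟨y, h.1⟩⟩
  refine le_antisymm (le_ciInf fun w => h.2 w w.2) ?_
  exact ciInf_le (f := fun w : K => ‖x - w‖) ⟨0, by rintro _ ⟨w, rfl⟩; exact norm_nonneg _⟩
    ⟨y, h.1⟩

theorem IsOrthProj.norm_sub_le {E : Type*} [NormedAddCommGroup E] [InnerProductSpace ℝ E]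
    {K : Set E} (hK : Convex ℝ K) {x y x' y' : E} (h : IsOrthProj K x y)
    (h' : IsOrthProj K x' y') : ‖y - y'‖ ≤ ‖x - x'‖ := by
  have h1 := h.inner_le_zero hK h'.1
  have h2 := h'.inner_le_zero hK h.1
  have h3 : inner ℝ (x - x') (y - y') = ‖y - y'‖ ^ 2 -
      (inner ℝ (x - y) (y' - y) + inner ℝ (x' - y') (y - y')) := by
    rw [← real_inner_self_eq_norm_sq, ← neg_sub y y', inner_neg_right, neg_add_eq_sub,
      ← inner_sub_left, ← inner_sub_left]
    congr 1
    abel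
  have h4 := real_inner_le_norm (x - x') (y - y')
  by_contra! hlt
  nlinarith [norm_nonneg (x - x'), norm_nonneg (y - y')]

theorem exists_isOrthProj {E : Type*} [NormedAddCommGroup E] [InnerProductSpace ℝ E]
    [CompleteSpace E] {K : Set E} (hne : K.Nonempty) (hc : IsClosed K) (hK : Convex ℝ K) (x : E) :
    ∃ y, IsOrthProj K x y := by
  obtain ⟨y, hy, h⟩ := exists_norm_eq_iInf_of_complete_convex hne hc.isComplete hK x
  refine ⟨y, hy, fun z hz => h ▸ ?_⟩
  exact ciInf_le (f := fun w : K => ‖x - w‖) ⟨0, by rintro _ ⟨w, rfl⟩; exact norm_nonneg _⟩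
    ⟨z, hz⟩

variable {N d : ℕ}

/-- The product `S^N`. -/
def powSet (N : ℕ) {d : ℕ} (S : Set (EuclideanSpace ℝ (Fin d))) : Set (Stack N d) :=
  {x | ∀ i, x i ∈ S}

theorem convex_powSet {S : Set (EuclideanSpace ℝ (Fin d))} (hS : Convex ℝ S) :
    Convex ℝ (powSet N S) :=
  fun _ hx _ hy _ _ ha hb hab i => hS (hx i) (hy i) ha hb hab

theorem kron_mem_powSet {S : Set (EuclideanSpace ℝ (Fin d))} (hS : Convex ℝ S) {η : ℝ}
    {W : Matrix (Fin N) (Fin N) ℝ} (hW : IsAveraging η W) {x : Stack N d} (hx : x ∈ powSet N S) :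
    kron W x ∈ powSet N S :=
  fun i => hS.sum_mem (fun j _ => hW.nonneg i j) (hW.row i) fun j _ => hx j

/-- The stack with all blocks equal to `m`. -/
noncomputable def constStack (N : ℕ) {d : ℕ} (m : EuclideanSpace ℝ (Fin d)) : Stack N d :=
  WithLp.toLp 2 fun _ => m

theorem IsOrthProj.constStack {S : Set (EuclideanSpace ℝ (Fin d))} {m p : EuclideanSpace ℝ (Fin d)}
    (h : IsOrthProj S m p) :
    IsOrthProj (powSet N S) (constStack N m) (constStack N p) := by
  refine ⟨fun _ => h.1, fun z hz => le_of_sq_le_sq ?_ (norm_nonneg _)⟩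
  rw [PiLp.norm_sq_eq_of_L2, PiLp.norm_sq_eq_of_L2]
  exact Finset.sum_le_sum fun i _ => pow_le_pow_left₀ (norm_nonneg _) (h.2 _ (hz i)) 2

theorem kron_lapK_constStack (hN : 1 ≤ N) (m : EuclideanSpace ℝ (Fin d)) :
    kron (lapK N) (constStack N m) = 0 := by
  have hN' : (N : ℝ) ≠ 0 := by positivity
  refine stack_ext fun c => ?_
  funext i
  rw [coord_kron, lapK_mulVec]
  simp [coord, constStack]
  field_simp
  simp

theorem exists_sub_constStack (x : Stack N d) :
    ∃ m, x - constStack N m = kron (lapK N) x := by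
  refine ⟨(1 / (N : ℝ)) • ∑ j, x j, stack_ext fun c => ?_⟩
  funext i
  rw [coord_kron, lapK_mulVec]
  simp [coord, constStack]
  ring

theorem disagreement_le_norm_sub (hN : 1 ≤ N) (x z : Stack N d) (hz : z ∈ nullK N d) :
    disagreement x ≤ ‖x - z‖ := by
  have : disagreement x = disagreement (x - z) := by
    rw [disagreement, disagreement, kron_sub, show kron (lapK N) z = 0 from hz, sub_zero]
  exact this ▸ disagreement_le_norm hN _

/-- The consensus point nearest to `x` repeats the mean of its blocks. -/
theorem infDist_nullK (hN : 1 ≤ N) (x : Stack N d) :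
    Metric.infDist x (nullK N d) = disagreement x := by
  obtain ⟨m, hm⟩ := exists_sub_constStack x
  have hmem : constStack N m ∈ nullK N d := kron_lapK_constStack hN m
  refine le_antisymm ?_ ((Metric.le_infDist ⟨_, hmem⟩).2 fun z hz => ?_)
  · refine (Metric.infDist_le_dist_of_mem hmem).trans_eq ?_
    rw [dist_eq_norm, hm, disagreement]
  · rw [dist_eq_norm]
    exact disagreement_le_norm_sub hN x z hz

/-- Projecting all blocks onto the same convex set does not increase the disagreement. -/
theorem IsOrthProj.disagreement_le (hN : 1 ≤ N) {S : Set (EuclideanSpace ℝ (Fin d))}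
    (hSc : IsClosed S) (hS : Convex ℝ S) {x y : Stack N d} (h : IsOrthProj (powSet N S) x y) :
    disagreement y ≤ disagreement x := by
  obtain ⟨m, hm⟩ := exists_sub_constStack x
  -- Repeating `p` gives the projection of the repeated mean `m`, so nonexpansiveness puts `y`
  -- within `disagreement x` of a consensus point.
  obtain ⟨p, hp⟩ := exists_isOrthProj ⟨_, h.1 ⟨0, hN⟩⟩ hSc hS m
  refine (disagreement_le_norm_sub hN y _ (kron_lapK_constStack hN p)).trans ?_
  refine (h.norm_sub_le (convex_powSet hS) hp.constStack).trans_eq ?_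
  rw [hm, disagreement]

end Projection

/-! ### Disturbed and projected averaging. -/

section Dynamics

open Finset

variable {N d : ℕ}

/-- Averaging matrices that link every cut during each window `[k B, (k + 1) B)`, `k ≥ 1`. -/
structure IsMixing (η : ℝ) (B : ℕ) (W : ℕ → Matrix (Fin N) (Fin N) ℝ) : Prop where
  averaging : ∀ t, 1 ≤ t → IsAveraging η (W t)
  le_of_pos : ∀ t, 1 ≤ t → ∀ i j, i ≠ j → 0 < W t i j → η ≤ W t i j
  linked : ∀ k, 1 ≤ k → ∀ A : Set (Fin N), A.Nonempty → Aᶜ.Nonempty →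
    ∃ t < B, ∃ i ∈ A, ∃ j ∈ Aᶜ, η ≤ W (k * B + t) i j

theorem rate_bounds (hN : 1 ≤ N) {η : ℝ} (hη : 0 ≤ η) (hη1 : η ≤ 1) :
    3 / 4 ≤ rate N η ∧ rate N η ≤ 1 := by
  have hN' : (1 : ℝ) ≤ N := by exact_mod_cast hN
  have h1 : η / (4 * (N : ℝ) ^ 2) ≤ 1 / 4 := by
    rw [div_le_div_iff₀ (by positivity) (by norm_num)]
    nlinarith
  have h2 : 0 ≤ η / (4 * (N : ℝ) ^ 2) := by positivity
  unfold rate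
  constructor <;> linarith

/-- The exponent counts one step more than is made, to make up for the first step of the dynamics,
which is handled separately. -/
theorem IsMixing.disagreement_evolve {η : ℝ} (hη : 0 ≤ η) (hη1 : η ≤ 1) (hN : 1 ≤ N) {B : ℕ}
    (hB : 1 ≤ B) {W : ℕ → Matrix (Fin N) (Fin N) ℝ} (hW : IsMixing η B W) {s : ℕ} (hs : 1 ≤ s)
    (x : Stack N d) (n : ℕ) :
    disagreement (evolve W s x n) ≤
      16 / 9 * rate N η ^ ⌈((n + 1 : ℕ) : ℝ) / B⌉₊ * disagreement x := by
  obtain ⟨h1, h2⟩ := rate_bounds hN hη hη1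
  refine decay_of_windows hB h1 h2 (s := s) (f := fun n => disagreement (evolve W s x n))
    (fun n => disagreement_nonneg _) (antitone_nat_of_succ_le fun n => ?_) (fun k n hk => ?_) n
  · exact disagreement_kron_le hN (hW.averaging _ (by omega)) _
  · have hk1 : 1 ≤ k := Nat.one_le_iff_ne_zero.2 (by rintro rfl; omega)
    have hkB : 1 ≤ k * B := Nat.mul_pos hk1 hB
    exact disagreement_window hη hη1 hN (W := fun t => W (k * B + t))
      (x := fun t => evolve W s x (n + t)) (fun t _ => hW.averaging _ (by omega))
      (fun t _ => hW.le_of_pos _ (by omega)) (hW.linked k hk1)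
      fun t _ => by rw [← hk, add_assoc s n t]; rfl

theorem disagreement_le_sum {η : ℝ} (hη : 0 ≤ η) (hη1 : η ≤ 1) (hN : 1 ≤ N) {B : ℕ} (hB : 1 ≤ B)
    {W : ℕ → Matrix (Fin N) (Fin N) ℝ} (hW : IsMixing η B W)
    {S : Set (EuclideanSpace ℝ (Fin d))} (hSc : IsClosed S) (hS : Convex ℝ S)
    {u D : ℕ → Stack N d}
    (hD : ∀ t, 1 ≤ t → IsOrthProj (powSet N S) (kron (W t) (D t) + u t) (D (t + 1))) (m : ℕ) :
    disagreement (D (m + 1)) ≤ 16 / 9 * rate N η ^ ⌈(m : ℝ) / B⌉₊ * disagreement (D 1) +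
      32 / 9 * ∑ i ∈ range m, (rate N η ^ (1 / (B : ℝ))) ^ (m - 1 - i) * ‖u (i + 1)‖ := by
  obtain ⟨h1, h2⟩ := rate_bounds hN hη hη1
  have hρ : 0 < rate N η := by linarith
  set ρ := rate N η
  have hpow : ∀ a b : ℕ, a ≤ b → ρ ^ ⌈(b : ℝ) / B⌉₊ ≤ (ρ ^ (1 / (B : ℝ))) ^ a := fun a b hab =>
    (pow_ceil_div_anti hρ.le h2 hab).trans (pow_ceil_div_le hρ h2 a)
  rcases m with _ | n
  · have := disagreement_nonneg (D 1)
    simp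
    linarith
  -- `D 1` may lie outside `S^N`, so the first projection residual is not controlled by `u 1`.
  have hstart : disagreement (D 2) ≤ disagreement (D 1) + ‖u 1‖ :=
    ((hD 1 le_rfl).disagreement_le hN hSc hS).trans <| (disagreement_add_le _ _).trans <|
      add_le_add (disagreement_kron_le hN (hW.averaging 1 le_rfl) _) (disagreement_le_norm hN _)
  set w : ℕ → Stack N d := fun t => D (t + 1) - kron (W t) (D t) with hw
  have hwn : ∀ t, 2 ≤ t → ‖w t‖ ≤ 2 * ‖u t‖ := by
    intro t ht
    have hmem : D t ∈ powSet N S := by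
      obtain ⟨s, rfl⟩ : ∃ s, t = s + 1 := ⟨t - 1, by omega⟩
      exact (hD s (by omega)).1
    -- The average of `D t` is a competitor in `S^N` at distance `‖u t‖` from the point being
    -- projected.
    have h3 := (hD t (by omega)).2 _ (kron_mem_powSet hS (hW.averaging t (by omega)) hmem)
    rw [add_sub_cancel_left] at h3
    calc ‖w t‖ = ‖u t - (kron (W t) (D t) + u t - D (t + 1))‖ := by
          congr 1; simp only [hw]; abel
      _ ≤ ‖u t‖ + ‖kron (W t) (D t) + u t - D (t + 1)‖ := norm_sub_le _ _
      _ ≤ 2 * ‖u t‖ := by linarith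
  have hsol := eq_evolve_add_sum (W := W) (s := 2) (X := D) (w := w)
    (fun t _ => (add_sub_cancel _ _).symm) n
  have hmain : disagreement (evolve W 2 (D 2) n) ≤
      16 / 9 * ρ ^ ⌈((n + 1 : ℕ) : ℝ) / B⌉₊ * disagreement (D 1) +
        32 / 9 * ((ρ ^ (1 / (B : ℝ))) ^ n * ‖u 1‖) := by
    have h4 := hW.disagreement_evolve hη hη1 hN hB (s := 2) (by norm_num) (D 2) n
    have h5 : 16 / 9 * ρ ^ ⌈((n + 1 : ℕ) : ℝ) / B⌉₊ * disagreement (D 2) ≤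
        16 / 9 * ρ ^ ⌈((n + 1 : ℕ) : ℝ) / B⌉₊ * (disagreement (D 1) + ‖u 1‖) :=
      mul_le_mul_of_nonneg_left hstart (by positivity)
    have h6 := mul_le_mul_of_nonneg_right (hpow n (n + 1) n.le_succ) (norm_nonneg (u 1))
    have h7 : 0 ≤ (ρ ^ (1 / (B : ℝ))) ^ n * ‖u 1‖ := by positivity
    linarith
  have hterm : ∀ i ∈ range n, disagreement (evolve W (2 + i + 1) (w (2 + i)) (n - 1 - i)) ≤
      32 / 9 * ((ρ ^ (1 / (B : ℝ))) ^ (n + 1 - 1 - (i + 1)) * ‖u (i + 1 + 1)‖) := by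
    intro i hi
    have hi' := mem_range.1 hi
    have h4 := hW.disagreement_evolve hη hη1 hN hB (s := 2 + i + 1) (by omega) (w (2 + i))
      (n - 1 - i)
    have h5 : disagreement (w (2 + i)) ≤ 2 * ‖u (i + 1 + 1)‖ := by
      rw [show i + 1 + 1 = 2 + i by omega]
      exact (disagreement_le_norm hN _).trans (hwn _ (by omega))
    have h6 := hpow (n + 1 - 1 - (i + 1)) (n - 1 - i + 1) (by omega)
    calc _ ≤ _ := h4
      _ ≤ 16 / 9 * (ρ ^ (1 / (B : ℝ))) ^ (n + 1 - 1 - (i + 1)) * (2 * ‖u (i + 1 + 1)‖) :=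
        mul_le_mul (by linarith) h5 (disagreement_nonneg _) (by positivity)
      _ = _ := by ring
  rw [sum_range_succ', show n + 1 + 1 = 2 + n by omega, hsol]
  refine (disagreement_add_le _ _).trans ?_
  have h8 := (disagreement_sum_le (range n)
    fun i => evolve W (2 + i + 1) (w (2 + i)) (n - 1 - i)).trans (sum_le_sum hterm)
  rw [← mul_sum] at h8
  rw [mul_add]
  simp only [Nat.add_sub_cancel, Nat.sub_zero, Nat.zero_add] at h8 ⊢
  linarith

theorem convolution_succ (q : ℝ) (a : ℕ → ℝ) (m : ℕ) :
    ∑ i ∈ range (m + 1), q ^ (m + 1 - 1 - i) * a i =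
      q * ∑ i ∈ range m, q ^ (m - 1 - i) * a i + a m := by
  rw [sum_range_succ, mul_sum]
  congr 1
  · refine sum_congr rfl fun i hi => ?_
    have hi' := mem_range.1 hi
    rw [show m + 1 - 1 - i = m - 1 - i + 1 by omega, pow_succ]
    ring
  · simp

theorem convolution_le {q M : ℝ} (hq : 0 ≤ q) (hq1 : q ≤ 1) (hM : 0 ≤ M) {a : ℕ → ℝ} {m : ℕ}
    (ha : ∀ i < m, a i ≤ M) :
    (1 - q) * ∑ i ∈ range m, q ^ (m - 1 - i) * a i ≤ M := by
  induction m with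
  | zero => simpa
  | succ m ih =>
    rw [convolution_succ]
    have h1 := mul_le_mul_of_nonneg_left (ih fun i hi => ha i (by omega)) hq
    have h2 := mul_le_mul_of_nonneg_left (ha m (by omega)) (sub_nonneg.2 hq1)
    linarith

/-- With `c m` the inner sum, the recursion gives `∑_{m ≤ T} c m = q ∑_{m < T} c m + ∑ a`;
completing the sum on the right leaves `-q c T ≤ 0`. -/
theorem sum_convolution_le {q : ℝ} (hq : 0 ≤ q) {a : ℕ → ℝ} (ha : ∀ i, 0 ≤ a i) (T : ℕ) :
    (1 - q) * ∑ m ∈ range (T + 1), ∑ i ∈ range m, q ^ (m - 1 - i) * a i ≤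
      ∑ i ∈ range T, a i := by
  have h0 : 0 ≤ ∑ i ∈ range T, q ^ (T - 1 - i) * a i :=
    sum_nonneg fun i _ => mul_nonneg (pow_nonneg hq _) (ha i)
  have h1 : ∑ m ∈ range (T + 1), ∑ i ∈ range m, q ^ (m - 1 - i) * a i =
      q * ∑ m ∈ range T, ∑ i ∈ range m, q ^ (m - 1 - i) * a i + ∑ i ∈ range T, a i := by
    rw [sum_range_succ']
    simp_rw [convolution_succ, sum_add_distrib, ← mul_sum]
    simp
  have h2 := sum_range_succ (fun m => ∑ i ∈ range m, q ^ (m - 1 - i) * a i) T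
  nlinarith [mul_nonneg hq h0]

theorem sum_Icc_one_eq_range (f : ℕ → ℝ) (n : ℕ) :
    ∑ t ∈ Icc 1 n, f t = ∑ m ∈ range n, f (m + 1) := by
  rw [range_eq_Ico, ← Ico_add_one_right_eq_Icc, sum_Ico_add' f 0 n 1, zero_add]

theorem norm_le_maxNorm {E : Type*} [SeminormedAddGroup E] (u : ℕ → E) {i m : ℕ} (hi : i < m) :
    ‖u (i + 1)‖ ≤ maxNorm u (m + 1) := by
  have : ‖u (i + 1)‖₊ ≤ maxNorm u (m + 1) :=
    le_sup (f := fun s => ‖u s‖₊) (mem_Icc.2 ⟨by omega, by omega⟩)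
  exact_mod_cast this

theorem rate_rpow_bounds (hN : 1 ≤ N) {η : ℝ} (hη : 0 < η) (hη1 : η ≤ 1) {B : ℕ} (hB : 1 ≤ B) :
    0 < rate N η ^ (1 / (B : ℝ)) ∧ rate N η ^ (1 / (B : ℝ)) < 1 := by
  obtain ⟨h1, _⟩ := rate_bounds hN hη.le hη1
  have hB' : (0 : ℝ) < B := by exact_mod_cast hB
  have hN' : (0 : ℝ) < N := by exact_mod_cast hN
  refine ⟨Real.rpow_pos_of_pos (by linarith) _,
    Real.rpow_lt_one (by linarith) ?_ (by positivity)⟩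
  have : 0 < η / (4 * (N : ℝ) ^ 2) := by positivity
  unfold rate
  linarith

theorem disagreement_le_max {η : ℝ} (hη : 0 < η) (hη1 : η ≤ 1) (hN : 1 ≤ N) {B : ℕ} (hB : 1 ≤ B)
    {W : ℕ → Matrix (Fin N) (Fin N) ℝ} (hW : IsMixing η B W)
    {S : Set (EuclideanSpace ℝ (Fin d))} (hSc : IsClosed S) (hS : Convex ℝ S)
    {u D : ℕ → Stack N d}
    (hD : ∀ t, 1 ≤ t → IsOrthProj (powSet N S) (kron (W t) (D t) + u t) (D (t + 1))) (m : ℕ) :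
    disagreement (D (m + 1)) ≤ 16 / 9 * rate N η ^ ⌈(m : ℝ) / B⌉₊ * disagreement (D 1) +
      constU N B η * maxNorm u (m + 1) := by
  obtain ⟨hq, hq1⟩ := rate_rpow_bounds hN hη hη1 hB
  refine (disagreement_le_sum hη.le hη1 hN hB hW hSc hS hD m).trans ?_
  have := convolution_le hq.le hq1.le (maxNorm u (m + 1)).2 (a := fun i => ‖u (i + 1)‖) (m := m)
    fun i hi => norm_le_maxNorm u hi
  rw [mul_comm, ← le_div_iff₀ (sub_pos.2 hq1)] at this
  have h2 : constU N B η * maxNorm u (m + 1) =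
      32 / 9 * (maxNorm u (m + 1) / (1 - rate N η ^ (1 / (B : ℝ)))) := by
    unfold constU
    ring
  rw [h2]
  gcongr
  exact this

theorem sum_disagreement_le {η : ℝ} (hη : 0 < η) (hη1 : η ≤ 1) (hN : 1 ≤ N) {B : ℕ} (hB : 1 ≤ B)
    {W : ℕ → Matrix (Fin N) (Fin N) ℝ} (hW : IsMixing η B W)
    {S : Set (EuclideanSpace ℝ (Fin d))} (hSc : IsClosed S) (hS : Convex ℝ S)
    {u D : ℕ → Stack N d}
    (hD : ∀ t, 1 ≤ t → IsOrthProj (powSet N S) (kron (W t) (D t) + u t) (D (t + 1))) (T : ℕ) :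
    ∑ t ∈ Icc 1 (T + 1), disagreement (D t) ≤
      constU N B η * (disagreement (D 1) / 2 + ∑ t ∈ Icc 1 T, ‖u t‖) := by
  obtain ⟨hq, hq1⟩ := rate_rpow_bounds hN hη hη1 hB
  obtain ⟨h1, h2⟩ := rate_bounds hN hη.le hη1
  rw [sum_Icc_one_eq_range, sum_Icc_one_eq_range]
  have hle := sum_le_sum fun m (_ : m ∈ range (T + 1)) =>
    disagreement_le_sum hη.le hη1 hN hB hW hSc hS hD m
  have hconst : constU N B η = 32 / 9 / (1 - rate N η ^ (1 / (B : ℝ))) := by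
    unfold constU
    norm_num
  have hsum := sum_convolution_le hq.le (a := fun i => ‖u (i + 1)‖) (fun _ => norm_nonneg _) T
  rw [sum_add_distrib, ← sum_mul, ← mul_sum, ← mul_sum] at hle
  have hp := sum_le_sum fun m (_ : m ∈ range (T + 1)) =>
    pow_ceil_div_le (B := B) (by linarith : 0 < rate N η) h2 m
  set q := rate N η ^ (1 / (B : ℝ))
  have hgeom : (∑ m ∈ range (T + 1), q ^ m) * (1 - q) ≤ 1 := by
    rw [mul_comm, mul_neg_geom_sum]
    linarith [pow_pos hq (T + 1)]
  have h3 : ∑ m ∈ range (T + 1), rate N η ^ ⌈(m : ℝ) / B⌉₊ ≤ 1 / (1 - q) :=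
    hp.trans ((le_div_iff₀ (sub_pos.2 hq1)).2 hgeom)
  rw [mul_comm, ← le_div_iff₀ (sub_pos.2 hq1)] at hsum
  have h4 := mul_le_mul_of_nonneg_right h3 (disagreement_nonneg (D 1))
  rw [hconst]
  -- `16 / 9` is half of `32 / 9`, whence the initial disagreement enters with a factor `1 / 2`.
  calc _ ≤ _ := hle
    _ ≤ 16 / 9 * (1 / (1 - q) * disagreement (D 1)) +
        32 / 9 * ((∑ i ∈ range T, ‖u (i + 1)‖) / (1 - q)) := by
      linarith
    _ = _ := by ring

theorem isISS_nullK (hN : 1 ≤ N) {F : Type*} [NormedAddCommGroup F]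
    {Traj : (ℕ → F) → (ℕ → Stack N d) → Prop} {q C : ℝ} (hq : 0 < q) (hq1 : q < 1) (hC : 0 ≤ C)
    (h : ∀ u x, Traj u x → ∀ m : ℕ, disagreement (x (m + 1)) ≤
      16 / 9 * q ^ m * disagreement (x 1) + C * maxNorm u (m + 1)) :
    IsISS Traj (nullK N d) := by
  lift q to ℝ≥0 using hq.le
  lift C to ℝ≥0 using hC
  have hq' : 0 < q := by exact_mod_cast hq
  have hq1' : q < 1 := by exact_mod_cast hq1
  -- `C + 1` rather than `C` keeps the gain strictly increasing even when `C = 0`.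
  refine ⟨fun r s => 16 / 9 * q ^ (s : ℝ) * r, fun r => (C + 1) * r, ⟨fun s => ⟨by fun_prop, ?_, by
    simp⟩, fun r => ⟨?_, ?_⟩⟩, ⟨by fun_prop, ?_, by simp⟩, ?_⟩
  · have : 0 < 16 / 9 * q ^ (s : ℝ) := by
      have := NNReal.rpow_pos (p := (s : ℝ)) hq'
      positivity
    exact fun a b hab => mul_lt_mul_of_pos_left hab this
  · intro a b hab
    have := NNReal.rpow_le_rpow_of_exponent_ge hq' hq1'.le (NNReal.coe_le_coe.2 hab)
    dsimp only
    gcongr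
  · have h1 : Filter.Tendsto (fun s : ℝ≥0 => q ^ (s : ℝ)) Filter.atTop (nhds 0) := by
      rw [← NNReal.tendsto_coe]
      push_cast
      exact (tendsto_rpow_atTop_of_base_lt_one (q : ℝ) (by linarith) hq1).comp
        (NNReal.tendsto_coe_atTop.2 Filter.tendsto_id)
    simpa using (h1.const_mul (16 / 9)).mul_const r
  · exact fun a b hab => mul_lt_mul_of_pos_left hab (by positivity)
  · intro u x hux t ht
    obtain ⟨m, rfl⟩ : ∃ m, t = m + 1 := ⟨t - 1, by omega⟩
    rw [infDist_nullK hN, infDist_nullK hN]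
    refine (h u x hux m).trans ?_
    push_cast [Real.coe_toNNReal _ (disagreement_nonneg (x 1))]
    simp only [Real.rpow_natCast]
    have : (0 : ℝ) ≤ maxNorm u (m + 1) := NNReal.coe_nonneg _
    linarith

end Dynamics

/-! ### From digraphs to mixing averaging matrices. -/

section Digraphs

open Finset

variable {N : ℕ}

theorem outDegree_nonneg (G : WeightedDigraph N) (i : Fin N) : 0 ≤ G.outDegree i :=
  sum_nonneg fun j _ => G.adj_nonneg i j

theorem adj_le_outDegree (G : WeightedDigraph N) (i j : Fin N) : G.adj i j ≤ G.outDegree i :=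
  single_le_sum (fun j _ => G.adj_nonneg i j) (mem_univ j)

theorem maxOutDegree_nonneg (G : ℕ → WeightedDigraph N) : 0 ≤ maxOutDegree G :=
  Real.sSup_nonneg (by rintro _ ⟨k, t, _, rfl⟩; exact outDegree_nonneg _ _)

theorem outDegree_le_max {G : ℕ → WeightedDigraph N} (hdeg : BddAbove (outDegrees G)) {t : ℕ}
    (ht : 1 ≤ t) (i : Fin N) : (G t).outDegree i ≤ maxOutDegree G :=
  le_csSup hdeg ⟨i, t, ht, rfl⟩

theorem deltaTilde_nonneg (G : ℕ → WeightedDigraph N) {δ δ' : ℝ} (hδ : 0 < δ)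
    (hδ' : δ' ∈ Set.Ioo (0 : ℝ) 1) : 0 ≤ deltaTilde G δ δ' :=
  le_min hδ'.1.le (mul_nonneg (sub_nonneg.2 hδ'.2.le) (div_nonneg hδ.le (maxOutDegree_nonneg G)))

theorem deltaTilde_le_one (G : ℕ → WeightedDigraph N) {δ δ' : ℝ}
    (hδ' : δ' ∈ Set.Ioo (0 : ℝ) 1) : deltaTilde G δ δ' ≤ 1 :=
  (min_le_left _ _).trans hδ'.2.le

/-- A strongly connected digraph has an edge leaving every proper nonempty set of vertices. -/
theorem WeightedDigraph.StronglyConnected.exists_edge {G : WeightedDigraph N}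
    (hG : G.StronglyConnected) {A : Set (Fin N)} (hA : A.Nonempty) (hA' : Aᶜ.Nonempty) :
    ∃ i ∈ A, ∃ j ∈ Aᶜ, (i, j) ∈ G.edges := by
  obtain ⟨i, hi⟩ := hA
  obtain ⟨j, hj⟩ := hA'
  by_contra! hno
  have : ∀ b, Relation.ReflTransGen (fun a b => (a, b) ∈ G.edges) i b → b ∈ A := by
    intro b hb
    induction hb with
    | refl => exact hi
    | @tail b c _ hbc ih =>
      by_contra hc
      exact hno b ih c hc hbc
  exact hj (this j (hG i j (by rintro rfl; exact hj hi)))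

theorem JointlyConnected.exists_edge {B : ℕ} {G : ℕ → WeightedDigraph N}
    (hconn : JointlyConnected B G) {k : ℕ} (hk : 1 ≤ k) {A : Set (Fin N)} (hA : A.Nonempty)
    (hA' : Aᶜ.Nonempty) : ∃ t < B, ∃ i ∈ A, ∃ j ∈ Aᶜ, 0 < (G (k * B + t)).adj i j := by
  obtain ⟨i, hi, j, hj, he⟩ := (hconn k hk).exists_edge hA hA'
  simp only [WeightedDigraph.biUnion, Set.mem_iUnion] at he
  obtain ⟨t, ht, he⟩ := he
  obtain ⟨h1, h2⟩ := mem_Ico.1 ht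
  rw [add_mul, one_mul] at h2
  refine ⟨t - k * B, by omega, i, hi, j, hj, ?_⟩
  rw [Nat.add_sub_of_le h1]
  exact ((G t).adj_pos_iff i j).2 he

theorem maxOutDegree_pos (hN : 2 ≤ N) {B : ℕ} (hB : 1 ≤ B) {G : ℕ → WeightedDigraph N}
    (hconn : JointlyConnected B G) (hdeg : BddAbove (outDegrees G)) : 0 < maxOutDegree G := by
  obtain ⟨t, _, i, _, j, _, h⟩ := hconn.exists_edge le_rfl
    (A := {⟨0, by omega⟩}) (Set.singleton_nonempty _)
    ⟨⟨1, by omega⟩, fun h => absurd (congrArg Fin.val h) one_ne_zero⟩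
  exact h.trans_le ((adj_le_outDegree _ i j).trans (outDegree_le_max hdeg (by omega) i))

/-- `hσδ` bounds the nonzero off-diagonal entries `σ a_ij` from below, `hσd` the diagonal ones. Rows
of the Laplacian sum to zero by construction, columns by weight balance. -/
theorem isMixing_laplacian {B : ℕ} (hB : 1 ≤ B) {G : ℕ → WeightedDigraph N} {δ η σ : ℝ} (hη : 0 ≤ η)
    (hconn : JointlyConnected B G) (hnondeg : Nondegenerate δ G)
    (hbal : ∀ t, 1 ≤ t → (G t).WeightBalanced) (hdeg : BddAbove (outDegrees G)) (hσ : 0 ≤ σ)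
    (hσδ : η ≤ σ * δ) (hσd : σ * maxOutDegree G ≤ 1 - η) :
    IsMixing η B fun t => 1 - σ • (G t).laplacian := by
  have hoff : ∀ t i j, i ≠ j →
      (1 - σ • (G t).laplacian : Matrix (Fin N) (Fin N) ℝ) i j = σ * (G t).adj i j := by
    intro t i j hij
    simp [WeightedDigraph.laplacian, Matrix.one_apply_ne hij, Matrix.diagonal_apply_ne _ hij]
  have hdiag : ∀ t i, (1 - σ • (G t).laplacian : Matrix (Fin N) (Fin N) ℝ) i i =
      1 - σ * (G t).outDegree i + σ * (G t).adj i i := by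
    intro t i
    simp [WeightedDigraph.laplacian]
    ring
  have hdiag_ge : ∀ t, 1 ≤ t → ∀ i,
      η ≤ (1 - σ • (G t).laplacian : Matrix (Fin N) (Fin N) ℝ) i i := by
    intro t ht i
    rw [hdiag]
    have h1 := mul_le_mul_of_nonneg_left (outDegree_le_max hdeg ht i) hσ
    have h2 := mul_nonneg hσ ((G t).adj_nonneg i i)
    linarith
  have hpos : ∀ t, 1 ≤ t → ∀ i j, 0 < (G t).adj i j → η ≤ σ * (G t).adj i j :=
    fun t ht i j h => hσδ.trans (mul_le_mul_of_nonneg_left (hnondeg t ht i j h).le hσ)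
  refine ⟨fun t ht => ⟨fun i j => ?_, fun i => ?_, fun j => ?_, hdiag_ge t ht⟩,
    fun t ht i j hij h => ?_, fun k hk A hA hA' => ?_⟩
  · rcases eq_or_ne i j with rfl | hij
    · exact hη.trans (hdiag_ge t ht i)
    · rw [hoff t i j hij]
      exact mul_nonneg hσ ((G t).adj_nonneg i j)
  · simp only [WeightedDigraph.laplacian, Matrix.sub_apply, Matrix.smul_apply, sum_sub_distrib,
      ← smul_sum, Matrix.one_apply, Matrix.diagonal_apply]
    simp [WeightedDigraph.outDegree]
  · simp only [WeightedDigraph.laplacian, Matrix.sub_apply, Matrix.smul_apply, sum_sub_distrib,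
      ← smul_sum, Matrix.one_apply, Matrix.diagonal_apply]
    have := hbal t ht j
    simp [this, WeightedDigraph.inDegree]
  · rw [hoff t i j hij] at h ⊢
    exact hpos t ht i j (pos_of_mul_pos_right h hσ)
  · obtain ⟨t, ht, i, hi, j, hj, h⟩ := hconn.exists_edge hk hA hA'
    have hij : i ≠ j := by rintro rfl; exact hj hi
    refine ⟨t, ht, i, hi, j, hj, ?_⟩
    rw [hoff _ i j hij]
    exact hpos _ (by have := Nat.mul_pos hk hB; omega) i j h

end Digraphs

/-! ### Splitting trajectories into components; final estimates. -/

section Trajectories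

open Finset

variable {N d e : ℕ}

theorem kron_one_sub_smul (L : Matrix (Fin N) (Fin N) ℝ) (σ : ℝ) (x : Stack N d) :
    kron (1 - σ • L) x = x - σ • kron L x := by
  refine stack_ext fun c => ?_
  rw [coord_kron, Matrix.sub_mulVec, Matrix.one_mulVec, Matrix.smul_mulVec, ← coord_kron]
  rfl

/-- Competitors sharing the second component of the projection reduce minimality in the product to
the first factor. -/
theorem IsOrthProj.fst {S : Set (EuclideanSpace ℝ (Fin d))} {T : Set (EuclideanSpace ℝ (Fin e))}
    {x x' : Stack N d} {y y' : Stack N e}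
    (h : IsOrthProj (prodSet N S T) (WithLp.toLp 2 (x, y)) (WithLp.toLp 2 (x', y'))) :
    IsOrthProj (powSet N S) x x' := by
  refine ⟨h.1.1, fun z hz => le_of_sq_le_sq ?_ (norm_nonneg _)⟩
  have h1 := pow_le_pow_left₀ (norm_nonneg _) (h.2 (WithLp.toLp 2 (z, y')) ⟨hz, h.1.2⟩) 2
  rw [WithLp.prod_norm_sq_eq_of_L2, WithLp.prod_norm_sq_eq_of_L2] at h1
  exact le_of_add_le_add_right h1

theorem IsOrthProj.snd {S : Set (EuclideanSpace ℝ (Fin d))} {T : Set (EuclideanSpace ℝ (Fin e))}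
    {x x' : Stack N d} {y y' : Stack N e}
    (h : IsOrthProj (prodSet N S T) (WithLp.toLp 2 (x, y)) (WithLp.toLp 2 (x', y'))) :
    IsOrthProj (powSet N T) y y' := by
  refine ⟨h.1.2, fun z hz => le_of_sq_le_sq ?_ (norm_nonneg _)⟩
  have h1 := pow_le_pow_left₀ (norm_nonneg _) (h.2 (WithLp.toLp 2 (x', z)) ⟨h.1.1, hz⟩) 2
  rw [WithLp.prod_norm_sq_eq_of_L2, WithLp.prod_norm_sq_eq_of_L2] at h1
  exact le_of_add_le_add_left h1

theorem IsTrajectory.fst {G : ℕ → WeightedDigraph N} {σ : ℝ}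
    {S : Set (EuclideanSpace ℝ (Fin d))} {T : Set (EuclideanSpace ℝ (Fin e))}
    {u₁ D : ℕ → Stack N d} {u₂ Z : ℕ → Stack N e} (h : IsTrajectory G σ S T u₁ D u₂ Z) (t : ℕ)
    (ht : 1 ≤ t) :
    IsOrthProj (powSet N S) (kron (1 - σ • (G t).laplacian) (D t) + u₁ t) (D (t + 1)) := by
  rw [kron_one_sub_smul]
  exact (h t ht).fst

theorem IsTrajectory.snd {G : ℕ → WeightedDigraph N} {σ : ℝ}
    {S : Set (EuclideanSpace ℝ (Fin d))} {T : Set (EuclideanSpace ℝ (Fin e))}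
    {u₁ D : ℕ → Stack N d} {u₂ Z : ℕ → Stack N e} (h : IsTrajectory G σ S T u₁ D u₂ Z) (t : ℕ)
    (ht : 1 ≤ t) :
    IsOrthProj (powSet N T) (kron (1 - σ • (G t).laplacian) (Z t) + u₂ t) (Z (t + 1)) := by
  rw [kron_one_sub_smul]
  exact (h t ht).snd

theorem disagreement_fin_one (x : Stack 1 d) : disagreement x = 0 := by
  have h := disagreement_sq x
  simp only [dispersion, univ_unique, sum_singleton, Nat.cast_one, div_one, sub_self] at h
  simpa using h

theorem constU_nonneg (hN : 1 ≤ N) {η : ℝ} (hη : 0 ≤ η) (hη1 : η ≤ 1) (B : ℕ) :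
    0 ≤ constU N B η := by
  obtain ⟨h1, h2⟩ := rate_bounds hN hη hη1
  exact div_nonneg (by norm_num)
    (sub_nonneg.2 (Real.rpow_le_one (by linarith) h2 (by positivity)))

/-- The single-component form of the estimates, with `q` the decay rate per step. -/
theorem exists_disagreement_bounds (hN : 1 ≤ N)
    (G : ℕ → WeightedDigraph N) (B : ℕ) (hB : 1 ≤ B) (δ : ℝ) (hδ : 0 < δ)
    (hconn : JointlyConnected B G) (hnondeg : Nondegenerate δ G)
    (hbal : ∀ t, 1 ≤ t → (G t).WeightBalanced)
    (hdeg : BddAbove (outDegrees G))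
    (δ' : ℝ) (hδ' : δ' ∈ Set.Ioo (0 : ℝ) 1)
    (σ : ℝ) (hσ : σ ∈ Set.Icc (deltaTilde G δ δ' / δ)
      ((1 - deltaTilde G δ δ') / maxOutDegree G)) :
    ∃ q : ℝ, 0 < q ∧ q < 1 ∧ ∀ (d : ℕ) (S : Set (EuclideanSpace ℝ (Fin d))), IsClosed S →
      Convex ℝ S → ∀ u D : ℕ → Stack N d,
      (∀ t, 1 ≤ t → IsOrthProj (powSet N S)
        (kron (1 - σ • (G t).laplacian) (D t) + u t) (D (t + 1))) →
      (∀ m : ℕ, disagreement (D (m + 1)) ≤ 16 / 9 * q ^ m * disagreement (D 1) +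
        constU N B (deltaTilde G δ δ') * maxNorm u (m + 1)) ∧
      (∀ t : ℕ, 1 ≤ t → disagreement (D t) ≤
        2 ^ 4 * ‖D 1‖ / 3 ^ 2 * rate N (deltaTilde G δ δ') ^ ⌈((t : ℝ) - 1) / B⌉₊ +
          constU N B (deltaTilde G δ δ') * maxNorm u t) ∧
      (∀ t' : ℕ, 1 ≤ t' → ∑ t ∈ Finset.Icc 1 t', disagreement (D t) ≤
        constU N B (deltaTilde G δ δ') *
          (‖D 1‖ / 2 + ∑ t ∈ Finset.Icc 1 (t' - 1), ‖u t‖)) := by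
  have hη0 := deltaTilde_nonneg G hδ hδ'
  have hη1 := deltaTilde_le_one G (δ := δ) hδ'
  obtain ⟨hr, hr1⟩ := rate_bounds hN hη0 hη1
  have hC := constU_nonneg hN hη0 hη1 B
  -- A single vertex never disagrees, so any `q` in `(0, 1)` serves. Here `maxOutDegree G` may be
  -- `0`; division by zero then makes `deltaTilde` and `constU` vanish.
  rcases hN.eq_or_lt with rfl | hN2
  · refine ⟨1 / 2, by norm_num, by norm_num, fun d S _ _ u D _ => ⟨fun m => ?_, fun t _ => ?_,
      fun t' _ => ?_⟩⟩
    · simp only [disagreement_fin_one, mul_zero, zero_add]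
      exact mul_nonneg hC (NNReal.coe_nonneg _)
    · rw [disagreement_fin_one]
      have : 0 ≤ rate 1 (deltaTilde G δ δ') := by linarith
      exact add_nonneg (by positivity) (mul_nonneg hC (NNReal.coe_nonneg _))
    · simp only [disagreement_fin_one, sum_const_zero]
      exact mul_nonneg hC (by positivity)
  · have hmax := maxOutDegree_pos hN2 hB hconn hdeg
    have hη : 0 < deltaTilde G δ δ' :=
      lt_min hδ'.1 (mul_pos (sub_pos.2 hδ'.2) (div_pos hδ hmax))
    have hσ0 : 0 ≤ σ := (div_nonneg hη.le hδ.le).trans hσ.1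
    have hW := isMixing_laplacian hB hη.le hconn hnondeg hbal hdeg hσ0
      ((div_le_iff₀ hδ).1 hσ.1) ((le_div_iff₀ hmax).1 hσ.2)
    obtain ⟨hq, hq1⟩ := rate_rpow_bounds hN hη hη1 hB
    refine ⟨_, hq, hq1, fun d S hSc hS u D hD => ⟨fun m => ?_, fun t ht => ?_, fun t' ht => ?_⟩⟩
    · refine (disagreement_le_max hη hη1 hN hB hW hSc hS hD m).trans ?_
      have := pow_ceil_div_le (B := B) (by linarith) hr1 m
      have h0 := disagreement_nonneg (D 1)
      gcongr
    · obtain ⟨m, rfl⟩ : ∃ m, t = m + 1 := ⟨t - 1, by omega⟩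
      refine (disagreement_le_max hη hη1 hN hB hW hSc hS hD m).trans ?_
      have h1 : 16 / 9 * rate N (deltaTilde G δ δ') ^ ⌈(m : ℝ) / B⌉₊ * disagreement (D 1) ≤
          16 / 9 * rate N (deltaTilde G δ δ') ^ ⌈(m : ℝ) / B⌉₊ * ‖D 1‖ :=
        mul_le_mul_of_nonneg_left (disagreement_le_norm hN _)
          (mul_nonneg (by norm_num) (pow_nonneg (by linarith) _))
      rw [Nat.cast_add_one, add_sub_cancel_right]
      linarith
    · obtain ⟨T, rfl⟩ : ∃ T, t' = T + 1 := ⟨t' - 1, by omega⟩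
      refine (sum_disagreement_le hη hη1 hN hB hW hSc hS hD T).trans ?_
      have := disagreement_le_norm hN (D 1)
      rw [Nat.add_sub_cancel]
      gcongr

end Trajectories

end LaplacianAveraging

theorem mainTheorem2 {N d e : ℕ} (hN : 1 ≤ N)
    (S : Set (EuclideanSpace ℝ (Fin d))) (hSc : IsClosed S) (hS : Convex ℝ S)
    (T : Set (EuclideanSpace ℝ (Fin e))) (hTc : IsClosed T) (hT : Convex ℝ T)
    (G : ℕ → WeightedDigraph N) (B : ℕ) (hB : 1 ≤ B) (δ : ℝ) (hδ : 0 < δ)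
    (hconn : JointlyConnected B G) (hnondeg : Nondegenerate δ G)
    (hbal : ∀ t, 1 ≤ t → (G t).WeightBalanced)
    (hdeg : BddAbove (outDegrees G))
    (δ' : ℝ) (hδ' : δ' ∈ Set.Ioo (0 : ℝ) 1)
    (σ : ℝ) (hσ : σ ∈ Set.Icc (deltaTilde G δ δ' / δ)
      ((1 - deltaTilde G δ δ') / maxOutDegree G)) :
    IsISS (fun u₁ D => ∃ u₂ Z, IsTrajectory G σ S T u₁ D u₂ Z) (nullK N d) ∧
    IsISS (fun u₂ Z => ∃ u₁ D, IsTrajectory G σ S T u₁ D u₂ Z) (nullK N e) ∧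
    ∀ (u₁ D : ℕ → Stack N d) (u₂ Z : ℕ → Stack N e), IsTrajectory G σ S T u₁ D u₂ Z →
      (∀ t : ℕ, 1 ≤ t → ‖kron (lapK N) (D t)‖ ≤
        2 ^ 4 * ‖D 1‖ / 3 ^ 2 * rate N (deltaTilde G δ δ') ^ ⌈((t : ℝ) - 1) / B⌉₊ +
          constU N B (deltaTilde G δ δ') * maxNorm u₁ t) ∧
      (∀ t' : ℕ, 1 ≤ t' → ∑ t ∈ Finset.Icc 1 t', ‖kron (lapK N) (D t)‖ ≤
        constU N B (deltaTilde G δ δ') *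
          (‖D 1‖ / 2 + ∑ t ∈ Finset.Icc 1 (t' - 1), ‖u₁ t‖)) ∧
      (∀ t : ℕ, 1 ≤ t → ‖kron (lapK N) (Z t)‖ ≤
        2 ^ 4 * ‖Z 1‖ / 3 ^ 2 * rate N (deltaTilde G δ δ') ^ ⌈((t : ℝ) - 1) / B⌉₊ +
          constU N B (deltaTilde G δ δ') * maxNorm u₂ t) ∧
      (∀ t' : ℕ, 1 ≤ t' → ∑ t ∈ Finset.Icc 1 t', ‖kron (lapK N) (Z t)‖ ≤
        constU N B (deltaTilde G δ δ') *
          (‖Z 1‖ / 2 + ∑ t ∈ Finset.Icc 1 (t' - 1), ‖u₂ t‖)) := by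
  have hC := constU_nonneg hN (deltaTilde_nonneg G hδ hδ') (deltaTilde_le_one G (δ := δ) hδ') B
  obtain ⟨q, hq, hq1, h⟩ :=
    exists_disagreement_bounds hN G B hB δ hδ hconn hnondeg hbal hdeg δ' hδ' σ hσ
  refine ⟨isISS_nullK hN hq hq1 hC ?_, isISS_nullK hN hq hq1 hC ?_, fun u₁ D u₂ Z hD => ?_⟩
  · rintro u D ⟨u₂, Z, hD⟩
    exact (h d S hSc hS u D hD.fst).1
  · rintro u Z ⟨u₁, D, hD⟩
    exact (h e T hTc hT u Z hD.snd).1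
  · obtain ⟨_, h1, h2⟩ := h d S hSc hS u₁ D hD.fst
    obtain ⟨_, h3, h4⟩ := h e T hTc hT u₂ Z hD.snd
    exact ⟨h1, h2, h3, h4⟩
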